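/- Let $A$ and $V$ be nonnegative self-adjoint operators in a separable complex Hilbert space $\mathcal H$, and let $\mathcal D\subseteq \mathrm{dom}(A)\cap\mathrm{dom}(V)$ be a linear subspace that is dense in $\mathcal H$ and such that, for some constants $a,b>0$, $$(Vf,f)\le a\,(Af,f)+b\,\|f\|^2,\qquad f\in\mathcal D .$$ Put $\dot A=A|_{\mathcal D}$ and, for $0<\alpha<1/a$, let $\hat H_\alpha$ be the Friedrichs extension of the densely defined symmetric operator $\dot H_\alpha=(A-\alpha V)|_{\mathcal D}$, which is bounded from below by $-\alpha b$. Let $\{V_n\}_{n\ge1}$ be a regularizing sequence of $V$, that is, a sequence of bounded nonnegative self-adjoint operators with $V_1\le V_2\le\dots\le V$ (in the sense of quadratic forms) and $\lim_{n\to\infty}(V_nf,f)=(Vf,f)$ for all $f\in\mathcal D$. Assume that it is admissible with respect to $\dot A$, that is, there is an $\eta<0$ such that $\sup_{n\ge1}(V_nh,h)=+\infty$ for every nonzero $h\in\ker(\dot A^*-\eta)$. If the deficiency indices $\dim\ker(\dot A^*\mp i)$ of $\dot A$ are finite, then for every self-adjoint extension $\tilde A$ of $\dot A$ and every coupling constant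 $\alpha$ with $0<\alpha<1/a$, $$\operatorname*{s-lim}_{n\to\infty}\,(\tilde A-\alpha V_n-z)^{-1}=(\hat H_\alpha-z)^{-1},\qquad \operatorname{Im} z\neq0 .$$ -/

import Mathlib

noncomputable section

namespace SingularPert

open Filter Topology
open scoped LinearPMap

variable {H : Type*} [NormedAddCommGroup H] [InnerProductSpace ℂ H]

/-- The real quadratic form `Re (T x, x)` of an operator, on its domain. -/
def quad (T : H →ₗ.[ℂ] H) (x : T.domain) : ℝ :=
  (inner ℂ (T x) (x : H)).re

/-- `T` is self-adjoint (in particular densely defined) and nonnegative. -/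
def IsNonnegSelfAdjoint [CompleteSpace H] (T : H →ₗ.[ℂ] H) : Prop :=
  IsSelfAdjoint T ∧ ∀ x : T.domain, 0 ≤ quad T x

/-- The form of `T` is bounded from below. -/
def IsSemibounded (T : H →ₗ.[ℂ] H) : Prop :=
  ∃ c : ℝ, ∀ x : T.domain, c * ‖(x : H)‖ ^ 2 ≤ quad T x

/-- `u` is a sequence in `dom T` with `u n → x` in `H` that is Cauchy for the form of `T`. -/
def FormConverges (T : H →ₗ.[ℂ] H) (u : ℕ → T.domain) (x : H) : Prop :=
  Tendsto (fun n => (u n : H)) atTop (𝓝 x) ∧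
    Tendsto (fun p : ℕ × ℕ => quad T (u p.1 - u p.2)) atTop (𝓝 0)

theorem quad_add_le {T : H →ₗ.[ℂ] H} {c : ℝ}
    (hc : ∀ x : T.domain, c * ‖(x : H)‖ ^ 2 ≤ quad T x) (x y : T.domain) :
    quad T (x + y) ≤ 2 * quad T x + 2 * quad T y - c * ‖(x : H) - y‖ ^ 2 := by
  have h := hc (x - y)
  have e : quad T (x + y) + quad T (x - y) = 2 * quad T x + 2 * quad T y := by
    simp only [quad, LinearPMap.map_add, LinearPMap.map_sub, Submodule.coe_add,
      Submodule.coe_sub, inner_add_left, inner_add_right, inner_sub_left, inner_sub_right,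
      Complex.add_re, Complex.sub_re]
    ring
  rw [Submodule.coe_sub] at h
  linarith

theorem quad_smul (T : H →ₗ.[ℂ] H) (z : ℂ) (x : T.domain) :
    quad T (z • x) = ‖z‖ ^ 2 * quad T x := by
  simp only [quad, LinearPMap.map_smul, Submodule.coe_smul, inner_smul_left, inner_smul_right]
  rw [← mul_assoc, mul_comm z, ← Complex.normSq_eq_conj_mul_self, Complex.re_ofReal_mul,
    Complex.normSq_eq_norm_sq]

theorem tendsto_sub_pair {E : Type*} [NormedAddCommGroup E] {u : ℕ → E} {x : E}
    (h : Tendsto u atTop (𝓝 x)) :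
    Tendsto (fun p : ℕ × ℕ => u p.1 - u p.2) atTop (𝓝 0) := by
  rw [← prod_atTop_atTop_eq]
  simpa using (h.comp tendsto_fst).sub (h.comp tendsto_snd)

/-- The domain of the closure of the form of a semibounded operator. -/
def formDomain (T : H →ₗ.[ℂ] H) (hT : IsSemibounded T) : Submodule ℂ H where
  carrier := {x | ∃ u : ℕ → T.domain, FormConverges T u x}
  zero_mem' := ⟨fun _ => 0, by simp [FormConverges, quad]⟩
  add_mem' := by
    rintro x y ⟨u, hu, hu'⟩ ⟨v, hv, hv'⟩
    obtain ⟨c, hc⟩ := hT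
    refine ⟨fun n => u n + v n, by simpa using hu.add hv, ?_⟩
    have du := tendsto_sub_pair hu
    have dv := tendsto_sub_pair hv
    have l : Tendsto (fun p : ℕ × ℕ =>
        c * ‖(((u p.1 - u p.2) + (v p.1 - v p.2) : T.domain) : H)‖ ^ 2) atTop (𝓝 0) := by
      simpa using ((du.add dv).norm.pow 2).const_mul c
    have r : Tendsto (fun p : ℕ × ℕ => 2 * quad T (u p.1 - u p.2) + 2 * quad T (v p.1 - v p.2)
        - c * ‖((u p.1 - u p.2 : T.domain) : H) - ((v p.1 - v p.2 : T.domain) : H)‖ ^ 2)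
        atTop (𝓝 0) := by
      simpa using ((hu'.const_mul 2).add (hv'.const_mul 2)).sub
        (((du.sub dv).norm.pow 2).const_mul c)
    have e : ∀ p : ℕ × ℕ, (u p.1 + v p.1) - (u p.2 + v p.2)
        = (u p.1 - u p.2) + (v p.1 - v p.2) := fun p => by abel
    simp only [e]
    exact tendsto_of_tendsto_of_tendsto_of_le_of_le l r (fun p => hc _)
      (fun p => quad_add_le hc _ _)
  smul_mem' := by
    rintro z x ⟨u, hu, hu'⟩
    refine ⟨fun n => z • u n, by simpa using hu.const_smul z, ?_⟩
    simpa only [← smul_sub, quad_smul, mul_zero] using hu'.const_mul (‖z‖ ^ 2)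

/-- The Friedrichs extension of a (densely defined, symmetric) semibounded operator `T`: the
restriction of the adjoint of `T` to those elements of its domain that lie in the domain of the
closed form of `T`. -/
def friedrichs [CompleteSpace H] (T : H →ₗ.[ℂ] H) (hT : IsSemibounded T) : H →ₗ.[ℂ] H :=
  (T†).domRestrict (formDomain T hT)

/-- `ker (T - z)`. -/
def kerSub (T : H →ₗ.[ℂ] H) (z : ℂ) : Submodule ℂ H :=
  (LinearMap.ker (T.toFun - z • T.domain.subtype)).map T.domain.subtype

/-- Both deficiency indices `dim ker (T† ∓ i)` of `T` are finite. -/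
def HasFiniteDeficiencyIndices [CompleteSpace H] (T : H →ₗ.[ℂ] H) : Prop :=
  FiniteDimensional ℂ (kerSub T† Complex.I) ∧ FiniteDimensional ℂ (kerSub T† (-Complex.I))

/-- `T - B` for a bounded operator `B`, with domain `dom T`. -/
def subBounded (T : H →ₗ.[ℂ] H) (B : H →L[ℂ] H) : H →ₗ.[ℂ] H where
  domain := T.domain
  toFun := T.toFun - (B : H →ₗ[ℂ] H).comp T.domain.subtype

/-- The bounded operator `R` is the resolvent `(T - z)⁻¹`. -/
def IsResolvent (T : H →ₗ.[ℂ] H) (z : ℂ) (R : H →L[ℂ] H) : Prop :=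
  (∀ f : H, ∃ h : R f ∈ T.domain, T ⟨R f, h⟩ - z • R f = f) ∧
    ∀ x : T.domain, R (T x - z • (x : H)) = x

/-- Strong resolvent convergence: for each nonreal `z` all the resolvents exist (as bounded
operators defined everywhere) and those of `T n` converge strongly to the one of `S`. -/
def StrongResolventTendsto (T : ℕ → H →ₗ.[ℂ] H) (S : H →ₗ.[ℂ] H) : Prop :=
  ∀ z : ℂ, z.im ≠ 0 → ∃ (R : ℕ → H →L[ℂ] H) (Q : H →L[ℂ] H),
    (∀ n, IsResolvent (T n) z (R n)) ∧ IsResolvent S z Q ∧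
      ∀ f : H, Tendsto (fun n => R n f) atTop (𝓝 (Q f))

/-- `W` is a regularizing sequence of `V` with respect to `D ⊆ dom V`: bounded nonnegative
self-adjoint operators `W 0 ≤ W 1 ≤ ... ≤ V` whose forms converge to that of `V` on `D`. -/
structure IsRegularizing [CompleteSpace H] (V : H →ₗ.[ℂ] H) (D : Submodule ℂ H)
    (W : ℕ → H →L[ℂ] H) : Prop where
  pos : ∀ n, (W n).IsPositive
  mono : Monotone W
  le : ∀ n, ∀ x : V.domain, (inner ℂ (W n x) (x : H)).re ≤ quad V x
  tendsto : ∀ x : V.domain, (x : H) ∈ D →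
    Tendsto (fun n => (inner ℂ (W n x) (x : H)).re) atTop (𝓝 (quad V x))

/-- Admissibility with respect to `T`: for some `η < 0`, `sup_n (W n h, h) = ∞` for every nonzero
`h ∈ ker (T† - η)`. -/
def IsAdmissible [CompleteSpace H] (T : H →ₗ.[ℂ] H) (W : ℕ → H →L[ℂ] H) : Prop :=
  ∃ η : ℝ, η < 0 ∧ ∀ h ∈ kerSub T† (η : ℂ), h ≠ 0 →
    ¬ BddAbove (Set.range fun n => (inner ℂ (W n h) h).re)

/-- The operator `(A - α V)|D`. -/
def minimalOp (A V : H →ₗ.[ℂ] H) (D : Submodule ℂ H) (α : ℝ) : H →ₗ.[ℂ] H :=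
  (A - (α : ℂ) • V).domRestrict D

/-- If `V ≤ a A + b` on `D` in the form sense and `0 < α < 1 / a`, then `(A - α V)|D` is
semibounded with lower bound `- α b`. -/
theorem isSemibounded_minimalOp {A V : H →ₗ.[ℂ] H} {D : Submodule ℂ H} {a b α : ℝ}
    (hA : ∀ x : A.domain, 0 ≤ quad A x) (ha : 0 < a) (hα : 0 < α) (hαa : α < 1 / a)
    (hV : ∀ (f : H) (hf : f ∈ A.domain) (hf' : f ∈ V.domain), f ∈ D →
      quad V ⟨f, hf'⟩ ≤ a * quad A ⟨f, hf⟩ + b * ‖f‖ ^ 2) :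
    IsSemibounded (minimalOp A V D α) := by
  refine ⟨-(α * b), ?_⟩
  rintro ⟨f, hf⟩
  have hf0 : f ∈ D ∧ f ∈ A.domain ∧ f ∈ V.domain := hf
  obtain ⟨hfD, hfA, hfV⟩ := hf0
  have e : quad (minimalOp A V D α) ⟨f, hf⟩ = quad A ⟨f, hfA⟩ - α * quad V ⟨f, hfV⟩ := by
    change (inner ℂ (A ⟨f, hfA⟩ - (α : ℂ) • V ⟨f, hfV⟩) f).re = _
    rw [inner_sub_left, inner_smul_left, Complex.conj_ofReal, Complex.sub_re,
      Complex.re_ofReal_mul]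
    rfl
  rw [e]
  have h1 := mul_le_mul_of_nonneg_left (hV f hfA hfV hfD) hα.le
  have h2 : α * a < 1 := by rwa [lt_div_iff₀ ha] at hαa
  have h3 := mul_nonneg (sub_nonneg.2 h2.le) (hA ⟨f, hfA⟩)
  show -(α * b) * ‖f‖ ^ 2 ≤ _
  nlinarith

end SingularPert

end

/-! Write `T = A|_D`, `S = (A - αV)|_D`, and `u n = (At - α W n - z)⁻¹ f`. Along the Friedrichs
extension of `T`, split `u n = x n + h n`, with `x n` in its domain and `h n` in the defect space
`ker (T† - η)`. The choice of `At` enters only through `h n`, so the claim reduces to showing that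
the growth of `W n` on the defect space forces `h n → 0`, while `x n` stays bounded in the form of
`T`.

Finite deficiency makes the admissibility condition uniform: the defect space at `η` embeds into the
one at `i`, and compactness of its unit sphere together with monotonicity gives `(W n h, h) ≥ M
‖h‖²` there for all large `n`, whatever `M` (`exists_forall_mul_norm_sq_le`). Testing the resolvent
equation with `x - h` cancels the real parts of the cross terms of `W n` and leaves `α ((W n x, x) -
(W n h, h))`. The first form is absorbed because `α a < 1`; the second has the good sign and
dominates the boundary term `((At - η) u, h)`, which is `O(‖h‖²)` by `exists_norm_inner_defect_le`.
This bounds the form at `x n`, the norm of `x n` and `(W n h n, h n)`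
(`exists_eventually_decomposition_bounded`), whence `h n → 0`.

For `φ ∈ D`, Cauchy–Schwarz for `W n - W m` and for `V - W n` then gives `((S - conj z) φ, x n) →
(φ, f)`. Vectors of the Friedrichs domain of `S` are form limits of such `φ`, with errors uniform on
form-bounded sets, so `u n` converges weakly to `(Ĥ_α - z)⁻¹ f`. Weak convergence of resolvents is
strong, since `Im (f, R f) = Im z ‖R f‖²` yields convergence of norms
(`tendsto_resolvent_of_tendsto_inner`). -/

noncomputable section

namespace SingularPert

open Filter Topology
open scoped LinearPMap

/-! ### Symmetric and self-adjoint operators, resolvents at nonreal points -/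

section

variable {H : Type*} [NormedAddCommGroup H] [InnerProductSpace ℂ H]

/-- The Cauchy–Schwarz inequality for the nonnegative hermitian form `(S x, ι y)`. -/
theorem norm_inner_sq_le {E : Type*} [AddCommGroup E] [Module ℂ E] (S ι : E →ₗ[ℂ] H)
    (hs : ∀ x y, inner ℂ (S x) (ι y) = inner ℂ (ι x) (S y))
    (hp : ∀ x, 0 ≤ (inner ℂ (S x) (ι x)).re) (x y : E) :
    ‖inner ℂ (S x) (ι y)‖ ^ 2 ≤ (inner ℂ (S x) (ι x)).re * (inner ℂ (S y) (ι y)).re := by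
  let c : PreInnerProductSpace.Core ℂ E :=
    { inner := fun x y => inner ℂ (S x) (ι y)
      conj_inner_symm := fun x y => by rw [inner_conj_symm, hs]
      re_inner_nonneg := hp
      add_left := fun x y z => by simp only [map_add, inner_add_left]
      smul_left := fun x y r => by simp only [map_smul, inner_smul_left] }
  have h := @InnerProductSpace.Core.inner_mul_inner_self_le ℂ E _ _ _ c x y
  have e : ‖inner ℂ (S y) (ι x)‖ = ‖inner ℂ (S x) (ι y)‖ := by
    rw [hs, norm_inner_symm]
  rw [sq]
  nth_rewrite 2 [← e]
  exact h

theorem IsFormalAdjoint.im_inner_self {T : H →ₗ.[ℂ] H} (hT : T.IsFormalAdjoint T)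
    (x : T.domain) : (inner ℂ (T x) (x : H)).im = 0 := by
  have h : (starRingEnd ℂ) (inner ℂ (T x) (x : H)) = inner ℂ (T x) (x : H) := by
    rw [inner_conj_symm, hT]
  exact Complex.conj_eq_iff_im.1 h

/-- For symmetric `T`, the imaginary part of `((T - z) x, x)` is `Im z ‖x‖²`. -/
theorem IsFormalAdjoint.im_inner_sub_smul {T : H →ₗ.[ℂ] H} (hT : T.IsFormalAdjoint T)
    (z : ℂ) (x : T.domain) :
    (inner ℂ (T x - z • (x : H)) (x : H)).im = z.im * ‖(x : H)‖ ^ 2 := by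
  rw [inner_sub_left, inner_smul_left, Complex.sub_im, IsFormalAdjoint.im_inner_self hT,
    inner_self_eq_norm_sq_to_K]
  simp [← Complex.ofReal_pow]

theorem IsFormalAdjoint.abs_im_mul_norm_le {T : H →ₗ.[ℂ] H} (hT : T.IsFormalAdjoint T)
    (z : ℂ) (x : T.domain) : |z.im| * ‖(x : H)‖ ≤ ‖T x - z • (x : H)‖ := by
  rcases eq_or_ne (x : H) 0 with h | h
  · simp [h]
  · have h1 := IsFormalAdjoint.im_inner_sub_smul hT z x
    have h2 := (Complex.abs_im_le_norm _).trans (norm_inner_le_norm (𝕜 := ℂ)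
      (T x - z • (x : H)) (x : H))
    rw [h1, abs_mul, abs_of_nonneg (sq_nonneg ‖(x : H)‖), sq, ← mul_assoc] at h2
    exact le_of_mul_le_mul_right h2 (norm_pos_iff.2 h)

theorem IsFormalAdjoint.inner_sub_smul {T : H →ₗ.[ℂ] H} (hT : T.IsFormalAdjoint T)
    (z : ℂ) (x y : T.domain) :
    inner ℂ (T x - z • (x : H)) (y : H)
      = inner ℂ (x : H) (T y - (starRingEnd ℂ) z • (y : H)) := by
  rw [inner_sub_left, inner_sub_right, inner_smul_left, inner_smul_right, hT]

/-- The resolvents of a symmetric operator at `z` and at `conj z` are adjoint to each other. -/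
theorem IsResolvent.inner_eq {T : H →ₗ.[ℂ] H} (hT : T.IsFormalAdjoint T) {z : ℂ}
    {R R' : H →L[ℂ] H} (hR : IsResolvent T z R) (hR' : IsResolvent T ((starRingEnd ℂ) z) R')
    (f g : H) : inner ℂ f (R' g) = inner ℂ (R f) g := by
  obtain ⟨h, e⟩ := hR.1 f
  obtain ⟨h', e'⟩ := hR'.1 g
  have := IsFormalAdjoint.inner_sub_smul hT z ⟨R f, h⟩ ⟨R' g, h'⟩
  rwa [e, e'] at this

variable [CompleteSpace H]

theorem isFormalAdjoint_of_isSelfAdjoint {T : H →ₗ.[ℂ] H} (hT : IsSelfAdjoint T) :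
    T.IsFormalAdjoint T := by
  have h := LinearPMap.adjoint_isFormalAdjoint hT.dense_domain
  rwa [LinearPMap.isSelfAdjoint_def.1 hT] at h

/-- An element `y` with `(w, x) = (y, T x)` for all `x` lies in the domain of the self-adjoint
operator `T`, and `T y = w`. -/
theorem exists_apply_eq_of_isSelfAdjoint {T : H →ₗ.[ℂ] H} (hT : IsSelfAdjoint T) {y w : H}
    (h : ∀ x : T.domain, inner ℂ w (x : H) = inner ℂ y (T x)) :
    ∃ hy : y ∈ T.domain, T ⟨y, hy⟩ = w := by
  have key : ∃ hy : y ∈ T†.domain, T† ⟨y, hy⟩ = w :=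
    ⟨LinearPMap.mem_adjoint_domain_of_exists y ⟨w, h⟩,
      LinearPMap.adjoint_apply_eq hT.dense_domain _ h⟩
  rwa [LinearPMap.isSelfAdjoint_def.1 hT] at key

/-- A densely defined symmetric operator is self-adjoint if its domain contains that of its
adjoint. -/
theorem isSelfAdjoint_of_adjoint_domain_le {T : H →ₗ.[ℂ] H} (hd : Dense (T.domain : Set H))
    (hT : T.IsFormalAdjoint T) (h : T†.domain ≤ T.domain) : IsSelfAdjoint T := by
  rw [LinearPMap.isSelfAdjoint_def]
  exact (LinearPMap.eq_of_le_of_domain_eq (hT.le_adjoint hd)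
    (le_antisymm (hT.le_adjoint hd).1 h)).symm

/-- The lower bound `|Im z| ‖x‖ ≤ ‖(T - z) x‖` makes the range closed: convergence of the images
forces convergence of the preimages, and self-adjointness puts the limit in the domain. A vector
orthogonal to the range is an eigenvector at `conj z`, which the same bound excludes. -/
theorem exists_sub_smul_eq_of_isSelfAdjoint {T : H →ₗ.[ℂ] H} (hT : IsSelfAdjoint T) {z : ℂ}
    (hz : z.im ≠ 0) (f : H) : ∃ x : T.domain, T x - z • (x : H) = f := by
  have hs := isFormalAdjoint_of_isSelfAdjoint hT
  let L : T.domain →ₗ[ℂ] H := T.toFun - z • T.domain.subtype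
  have hL : ∀ x : T.domain, L x = T x - z • (x : H) := fun x => rfl
  have hz' : 0 < |z.im| := abs_pos.2 hz
  have hclosed : IsClosed ((LinearMap.range L : Submodule ℂ H) : Set H) := by
    refine isClosed_of_closure_subset fun g hg => ?_
    obtain ⟨v, hv, hvg⟩ := mem_closure_iff_seq_limit.1 hg
    choose u hu using hv
    have hdist : ∀ m n, ‖(u m : H) - u n‖ ≤ |z.im|⁻¹ * ‖v m - v n‖ := fun m n => by
      have h := IsFormalAdjoint.abs_im_mul_norm_le hs z (u m - u n)
      rw [← hL, map_sub, hu, hu] at h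
      rw [inv_mul_eq_div, le_div_iff₀ hz', mul_comm]
      exact h
    have hcau : CauchySeq fun n => (u n : H) := by
      rw [cauchySeq_iff_tendsto_dist_atTop_0]
      have hv0 := (cauchySeq_iff_tendsto_dist_atTop_0.1 hvg.cauchySeq).const_mul |z.im|⁻¹
      rw [mul_zero] at hv0
      refine squeeze_zero (fun _ => dist_nonneg) (fun p => ?_) hv0
      rw [dist_eq_norm, dist_eq_norm]
      exact hdist _ _
    obtain ⟨x, hx⟩ := cauchySeq_tendsto_of_complete hcau
    have hTu : Tendsto (fun n => T (u n)) atTop (𝓝 (g + z • x)) := by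
      have := hvg.add (hx.const_smul z)
      refine this.congr fun n => ?_
      rw [← hu, hL]
      abel
    obtain ⟨hx', e⟩ := exists_apply_eq_of_isSelfAdjoint hT (y := x) (w := g + z • x) fun y =>
      tendsto_nhds_unique (hTu.inner tendsto_const_nhds)
        ((hx.inner tendsto_const_nhds).congr fun n => (hs (u n) y).symm)
    exact ⟨⟨x, hx'⟩, by rw [hL, e]; simp⟩
  have hbot : (LinearMap.range L)ᗮ = ⊥ := by
    rw [Submodule.eq_bot_iff]
    intro y hy
    have hy' : ∀ x : T.domain, inner ℂ ((starRingEnd ℂ) z • y) (x : H) = inner ℂ y (T x) := by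
      intro x
      have := (Submodule.mem_orthogonal' _ _).1 hy (L x) ⟨x, rfl⟩
      rw [hL, inner_sub_right, inner_smul_right, sub_eq_zero] at this
      rw [inner_smul_left, Complex.conj_conj, this]
    obtain ⟨hyd, e⟩ := exists_apply_eq_of_isSelfAdjoint hT hy'
    have h := IsFormalAdjoint.abs_im_mul_norm_le hs ((starRingEnd ℂ) z) ⟨y, hyd⟩
    rw [e, sub_self, norm_zero, Complex.conj_im, abs_neg] at h
    have h0 : ‖y‖ ≤ 0 := le_of_mul_le_mul_left (by simpa using h) hz'
    exact norm_le_zero_iff.1 h0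
  have htop : LinearMap.range L = ⊤ := by
    rw [← hclosed.submodule_topologicalClosure_eq,
      Submodule.topologicalClosure_eq_top_iff, hbot]
  obtain ⟨x, hx⟩ := LinearMap.range_eq_top.1 htop f
  exact ⟨x, hx⟩

theorem exists_isResolvent_of_isSelfAdjoint {T : H →ₗ.[ℂ] H} (hT : IsSelfAdjoint T) {z : ℂ}
    (hz : z.im ≠ 0) : ∃ R : H →L[ℂ] H, IsResolvent T z R := by
  have hs := isFormalAdjoint_of_isSelfAdjoint hT
  let L : T.domain →ₗ[ℂ] H := T.toFun - z • T.domain.subtype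
  have hL : ∀ x : T.domain, L x = T x - z • (x : H) := fun x => rfl
  have hz' : 0 < |z.im| := abs_pos.2 hz
  have hinj : Function.Injective L := by
    rw [injective_iff_map_eq_zero]
    intro x hx
    have h := IsFormalAdjoint.abs_im_mul_norm_le hs z x
    rw [← hL, hx, norm_zero] at h
    have h0 : ‖(x : H)‖ ≤ 0 := le_of_mul_le_mul_left (by simpa using h) hz'
    exact Subtype.ext (norm_le_zero_iff.1 h0)
  let e : T.domain ≃ₗ[ℂ] H := LinearEquiv.ofBijective L
    ⟨hinj, fun f => exists_sub_smul_eq_of_isSelfAdjoint hT hz f⟩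
  have he : ∀ f, L (e.symm f) = f := fun f => e.apply_symm_apply f
  refine ⟨(T.domain.subtype.comp e.symm.toLinearMap).mkContinuous |z.im|⁻¹ fun f => ?_,
    fun f => ⟨(e.symm f).2, he f⟩, fun x => ?_⟩
  · have h := IsFormalAdjoint.abs_im_mul_norm_le hs z (e.symm f)
    rw [← hL, he] at h
    rw [inv_mul_eq_div, le_div_iff₀ hz', mul_comm]
    exact h
  · exact congrArg Subtype.val (e.symm_apply_apply x)

theorem isSelfAdjoint_subBounded {T : H →ₗ.[ℂ] H} (hT : IsSelfAdjoint T) {B : H →L[ℂ] H}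
    (hB : ∀ x y, inner ℂ (B x) y = inner ℂ x (B y)) : IsSelfAdjoint (subBounded T B) := by
  have hs := isFormalAdjoint_of_isSelfAdjoint hT
  have hd : Dense ((subBounded T B).domain : Set H) := hT.dense_domain
  refine isSelfAdjoint_of_adjoint_domain_le hd ?_ fun y hy => ?_
  · rintro ⟨x, hx⟩ ⟨y, hy⟩
    change inner ℂ (T ⟨x, hx⟩ - B x) y = inner ℂ x (T ⟨y, hy⟩ - B y)
    rw [inner_sub_left, inner_sub_right, hB]
    exact congrArg (· - inner ℂ x (B y)) (hs ⟨x, hx⟩ ⟨y, hy⟩)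
  -- If `y` is in the domain of `(T - B)†`, then `(T - B)† y + B y` represents `x ↦ (y, T x)`, so
  -- `y` lies in `dom T† = dom T`.
  · refine (exists_apply_eq_of_isSelfAdjoint hT (y := y)
      (w := (subBounded T B)† ⟨y, hy⟩ + B y) fun x => ?_).1
    have h : inner ℂ ((subBounded T B)† ⟨y, hy⟩) (x : H) = inner ℂ y (T x - B x) :=
      LinearPMap.adjoint_isFormalAdjoint hd ⟨y, hy⟩ x
    rw [inner_sub_right] at h
    rw [inner_add_left, h, hB]
    simp

end

/-! ### Closed forms and self-adjointness of the Friedrichs extension -/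

section

variable {H : Type*} [NormedAddCommGroup H] [InnerProductSpace ℂ H]

/-- `T + μ` as a linear map on `dom T`. -/
def shift (T : H →ₗ.[ℂ] H) (μ : ℝ) : T.domain →ₗ[ℂ] H :=
  T.toFun + (μ : ℂ) • T.domain.subtype

theorem shift_apply (T : H →ₗ.[ℂ] H) (μ : ℝ) (x : T.domain) :
    shift T μ x = T x + (μ : ℂ) • (x : H) := rfl

/-- The quadratic form of `T + μ`. -/
def shiftQuad (T : H →ₗ.[ℂ] H) (μ : ℝ) (x : T.domain) : ℝ :=
  (inner ℂ (shift T μ x) (x : H)).re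

theorem shiftQuad_eq (T : H →ₗ.[ℂ] H) (μ : ℝ) (x : T.domain) :
    shiftQuad T μ x = quad T x + μ * ‖(x : H)‖ ^ 2 := by
  rw [shiftQuad, shift_apply, inner_add_left, inner_smul_left, Complex.add_re,
    Complex.conj_ofReal, Complex.re_ofReal_mul, inner_self_eq_norm_sq_to_K, quad]
  simp [← Complex.ofReal_pow]

theorem shiftQuad_nonneg {T : H →ₗ.[ℂ] H} {c μ : ℝ}
    (hc : ∀ x : T.domain, c * ‖(x : H)‖ ^ 2 ≤ quad T x) (hμ : 0 ≤ μ + c) (x : T.domain) :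
    (μ + c) * ‖(x : H)‖ ^ 2 ≤ shiftQuad T μ x ∧ 0 ≤ shiftQuad T μ x := by
  have h := hc x
  have h0 := mul_nonneg hμ (sq_nonneg ‖(x : H)‖)
  rw [shiftQuad_eq]
  constructor <;> nlinarith

variable {T : H →ₗ.[ℂ] H} {μ : ℝ}

theorem inner_shift_left (hs : T.IsFormalAdjoint T) (x y : T.domain) :
    inner ℂ (shift T μ x) (y : H) = inner ℂ (x : H) (shift T μ y) := by
  rw [shift_apply, shift_apply, inner_add_left, inner_add_right, inner_smul_left,
    inner_smul_right, hs, Complex.conj_ofReal]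

theorem norm_inner_shift_sq_le (hs : T.IsFormalAdjoint T) (hp : ∀ x, 0 ≤ shiftQuad T μ x)
    (x y : T.domain) :
    ‖inner ℂ (x : H) (shift T μ y)‖ ^ 2 ≤ shiftQuad T μ x * shiftQuad T μ y := by
  rw [← inner_shift_left hs]
  exact norm_inner_sq_le (shift T μ) T.domain.subtype (inner_shift_left hs) hp x y

theorem norm_inner_shift_le (hs : T.IsFormalAdjoint T) (hp : ∀ x, 0 ≤ shiftQuad T μ x)
    (x y : T.domain) :
    ‖inner ℂ (x : H) (shift T μ y)‖ ≤ √(shiftQuad T μ x) * √(shiftQuad T μ y) := by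
  rw [← Real.sqrt_mul (hp x)]
  exact Real.le_sqrt_of_sq_le (norm_inner_shift_sq_le hs hp x y)

theorem shiftQuad_add_le (hp : ∀ x, 0 ≤ shiftQuad T μ x) (x y : T.domain) :
    shiftQuad T μ (x + y) ≤ 2 * shiftQuad T μ x + 2 * shiftQuad T μ y := by
  have h := hp (x - y)
  have e : shiftQuad T μ (x + y) + shiftQuad T μ (x - y)
      = 2 * shiftQuad T μ x + 2 * shiftQuad T μ y := by
    simp only [shiftQuad, map_add, map_sub, Submodule.coe_add,
      Submodule.coe_sub, inner_add_left, inner_add_right, inner_sub_left, inner_sub_right,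
      Complex.add_re, Complex.sub_re]
    ring
  linarith

theorem FormConverges.tendsto_shiftQuad_sub {u : ℕ → T.domain} {x : H}
    (h : FormConverges T u x) :
    Tendsto (fun p : ℕ × ℕ => shiftQuad T μ (u p.1 - u p.2)) atTop (𝓝 0) := by
  simp only [shiftQuad_eq]
  simpa using h.2.add (((tendsto_sub_pair h.1).norm.pow 2).const_mul μ)

theorem FormConverges.exists_forall_shiftQuad_sub_le {u : ℕ → T.domain} {x : H}
    (h : FormConverges T u x) {ε : ℝ} (hε : 0 < ε) :
    ∃ N, ∀ m ≥ N, ∀ n ≥ N, shiftQuad T μ (u m - u n) ≤ ε := by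
  have h1 := (h.tendsto_shiftQuad_sub (μ := μ)).eventually (ge_mem_nhds hε)
  obtain ⟨⟨M, N⟩, hN⟩ := eventually_atTop.1 h1
  exact ⟨max M N, fun m hm n hn => hN (m, n) ⟨le_trans (le_max_left _ _) hm,
    le_trans (le_max_right _ _) hn⟩⟩

theorem FormConverges.eventually_shiftQuad_le (hp : ∀ x, 0 ≤ shiftQuad T μ x)
    {u : ℕ → T.domain} {x : H} (h : FormConverges T u x) :
    ∃ C, 0 ≤ C ∧ ∀ᶠ n in atTop, shiftQuad T μ (u n) ≤ C := by
  obtain ⟨N, hN⟩ := h.exists_forall_shiftQuad_sub_le (μ := μ) one_pos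
  refine ⟨2 + 2 * shiftQuad T μ (u N), by linarith [hp (u N)], eventually_atTop.2
    ⟨N, fun n hn => ?_⟩⟩
  have h1 := shiftQuad_add_le hp (u n - u N) (u N)
  rw [sub_add_cancel] at h1
  linarith [hN n hn N le_rfl]

/-- The approximation by a form-convergent sequence, seen through the form. -/
theorem FormConverges.eventually_norm_inner_sub_le (hs : T.IsFormalAdjoint T)
    (hp : ∀ x, 0 ≤ shiftQuad T μ x) {u : ℕ → T.domain} {x : H} (h : FormConverges T u x)
    {ε : ℝ} (hε : 0 < ε) :
    ∀ᶠ j in atTop, ∀ φ : T.domain,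
      ‖inner ℂ (x - u j) (shift T μ φ)‖ ≤ ε * √(shiftQuad T μ φ) := by
  obtain ⟨N, hN⟩ := h.exists_forall_shiftQuad_sub_le (μ := μ) (pow_pos hε 2)
  refine eventually_atTop.2 ⟨N, fun j hj φ => ?_⟩
  -- Cauchy–Schwarz bounds the pairing of `u i - u j`; then `i → ∞`.
  refine le_of_tendsto (((h.1.sub_const (u j : H)).inner tendsto_const_nhds).norm)
    (eventually_atTop.2 ⟨N, fun i hi => ?_⟩)
  refine (norm_inner_shift_le hs hp (u i - u j) φ).trans ?_
  gcongr
  rw [← Real.sqrt_sq hε.le]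
  exact Real.sqrt_le_sqrt (hN i hi j hj)

theorem shiftQuad_add_smul (hs : T.IsFormalAdjoint T) (φ ψ : T.domain) (t : ℂ) :
    shiftQuad T μ (φ + t • ψ)
      = shiftQuad T μ φ + 2 * (t * inner ℂ (shift T μ φ) (ψ : H)).re
        + ‖t‖ ^ 2 * shiftQuad T μ ψ := by
  have e1 : (inner ℂ (shift T μ (t • ψ)) (φ : H)).re
      = (t * inner ℂ (shift T μ φ) (ψ : H)).re := by
    rw [← inner_smul_right, inner_shift_left hs, ← Complex.conj_re, inner_conj_symm]
    rfl
  have e2 : (inner ℂ (shift T μ (t • ψ)) ((t • ψ : T.domain) : H)).re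
      = ‖t‖ ^ 2 * shiftQuad T μ ψ := by
    rw [map_smul, Submodule.coe_smul, inner_smul_left, inner_smul_right, ← mul_assoc,
      mul_comm _ t, Complex.mul_conj, Complex.re_ofReal_mul, Complex.normSq_eq_norm_sq, shiftQuad]
  rw [shiftQuad, map_add, Submodule.coe_add, inner_add_left, inner_add_right, inner_add_right,
    Complex.add_re, Complex.add_re, Complex.add_re, e1, e2, Submodule.coe_smul, inner_smul_right,
    show (inner ℂ (shift T μ φ) (φ : H)).re = shiftQuad T μ φ from rfl]
  ring

theorem domain_le_formDomain (hT : IsSemibounded T) : T.domain ≤ formDomain T hT :=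
  fun x hx => ⟨fun _ => ⟨x, hx⟩, tendsto_const_nhds, by simp [quad]⟩

variable [CompleteSpace H]

theorem inner_adjoint_shift (hd : Dense (T.domain : Set H)) (x : T†.domain) (φ : T.domain) :
    inner ℂ (T† x + (μ : ℂ) • (x : H)) (φ : H) = inner ℂ (x : H) (shift T μ φ) := by
  rw [shift_apply, inner_add_left, inner_add_right, inner_smul_left, inner_smul_right,
    Complex.conj_ofReal, LinearPMap.adjoint_isFormalAdjoint hd]

/-- `(T† x + μ x, v k)` equals `(x, (T + μ) v k)`, and replacing `x` by `u k` costs an arbitrarily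
small multiple of the form norm of `v k`, which stays bounded. Thus `T†` on the form domain is
represented by the closed form. -/
theorem FormConverges.tendsto_inner_shift (hd : Dense (T.domain : Set H))
    (hs : T.IsFormalAdjoint T) (hp : ∀ x, 0 ≤ shiftQuad T μ x) {u v : ℕ → T.domain}
    {x : T†.domain} {y : H} (hu : FormConverges T u x) (hv : FormConverges T v y) :
    Tendsto (fun k => inner ℂ (u k : H) (shift T μ (v k))) atTop
      (𝓝 (inner ℂ (T† x + (μ : ℂ) • (x : H)) y)) := by
  obtain ⟨C, hC, hvC⟩ := hv.eventually_shiftQuad_le hp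
  have h1 : Tendsto (fun k => inner ℂ (T† x + (μ : ℂ) • (x : H)) (v k : H)) atTop
      (𝓝 (inner ℂ (T† x + (μ : ℂ) • (x : H)) y)) := tendsto_const_nhds.inner hv.1
  have h2 : Tendsto (fun k => inner ℂ ((x : H) - u k) (shift T μ (v k))) atTop (𝓝 0) := by
    rw [Metric.tendsto_nhds]
    intro ε hε
    have hε' : 0 < ε / (√C + 1) := by positivity
    filter_upwards [hu.eventually_norm_inner_sub_le hs hp hε', hvC] with k hk hkC
    rw [dist_zero_right]
    calc _ ≤ ε / (√C + 1) * √(shiftQuad T μ (v k)) := hk _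
      _ ≤ ε / (√C + 1) * √C := by gcongr
      _ < ε / (√C + 1) * (√C + 1) := by gcongr; linarith
      _ = ε := by field_simp
  have h3 := h1.sub h2
  rw [sub_zero] at h3
  refine h3.congr fun k => ?_
  rw [inner_adjoint_shift hd, inner_sub_left]
  abel

theorem FormConverges.tendsto_shiftQuad (hd : Dense (T.domain : Set H))
    (hs : T.IsFormalAdjoint T) (hp : ∀ x, 0 ≤ shiftQuad T μ x) {u : ℕ → T.domain}
    {x : T†.domain} (hu : FormConverges T u x) :
    Tendsto (fun k => shiftQuad T μ (u k)) atTop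
      (𝓝 (inner ℂ (T† x + (μ : ℂ) • (x : H)) (x : H)).re) := by
  refine ((Complex.continuous_re.tendsto _).comp (hu.tendsto_inner_shift hd hs hp hu)).congr
    fun k => ?_
  rw [shiftQuad, inner_shift_left hs]
  rfl

theorem inner_adjoint_comm_of_mem_formDomain (hd : Dense (T.domain : Set H))
    (hs : T.IsFormalAdjoint T) (hT : IsSemibounded T) {x y : T†.domain}
    (hx : (x : H) ∈ formDomain T hT) (hy : (y : H) ∈ formDomain T hT) :
    inner ℂ (T† x) (y : H) = inner ℂ (x : H) (T† y) := by
  obtain ⟨c, hc⟩ := id hT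
  obtain ⟨u, hu⟩ := hx
  obtain ⟨v, hv⟩ := hy
  have hp : ∀ x, 0 ≤ shiftQuad T (-c) x := fun x => (shiftQuad_nonneg hc (by simp) x).2
  have h1 := hu.tendsto_inner_shift hd hs hp hv
  have h2 := (Complex.continuous_conj.tendsto _).comp (hv.tendsto_inner_shift hd hs hp hu)
  have h3 := tendsto_nhds_unique h1 (h2.congr fun k => by
    rw [Function.comp_apply, inner_conj_symm, inner_shift_left hs])
  rw [inner_conj_symm, inner_add_left, inner_add_right, inner_smul_left, inner_smul_right,
    Complex.conj_ofReal] at h3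
  exact add_right_cancel h3

theorem isFormalAdjoint_friedrichs (hd : Dense (T.domain : Set H))
    (hs : T.IsFormalAdjoint T) (hT : IsSemibounded T) :
    (friedrichs T hT).IsFormalAdjoint (friedrichs T hT) := by
  rintro ⟨x, hx⟩ ⟨y, hy⟩
  exact inner_adjoint_comm_of_mem_formDomain hd hs hT (x := ⟨x, hx.2⟩) (y := ⟨y, hy.2⟩) hx.1 hy.1

theorem domain_le_friedrichs_domain (hd : Dense (T.domain : Set H))
    (hs : T.IsFormalAdjoint T) (hT : IsSemibounded T) :
    T.domain ≤ (friedrichs T hT).domain :=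
  fun _ hx => ⟨domain_le_formDomain hT hx, (hs.le_adjoint hd).1 hx⟩

/-- `T† + μ` maps the domain of the Friedrichs extension onto `H`, if `- μ` lies below the lower
bound of `T`. The preimage of `g` is the limit of a minimizing sequence of
`((T + μ) φ, φ) - 2 Re (g, φ)`. -/
theorem exists_adjoint_add_smul_eq (hd : Dense (T.domain : Set H))
    (hs : T.IsFormalAdjoint T) (hT : IsSemibounded T) {c : ℝ}
    (hc : ∀ x : T.domain, c * ‖(x : H)‖ ^ 2 ≤ quad T x) (hμ : 0 < μ + c) (g : H) :
    ∃ x : T†.domain, (x : H) ∈ formDomain T hT ∧ T† x + (μ : ℂ) • (x : H) = g := by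
  have hp : ∀ x, 0 ≤ shiftQuad T μ x := fun x => (shiftQuad_nonneg hc hμ.le x).2
  have hlow : ∀ x : T.domain, (μ + c) * ‖(x : H)‖ ^ 2 ≤ shiftQuad T μ x :=
    fun x => (shiftQuad_nonneg hc hμ.le x).1
  let J : T.domain → ℝ := fun φ => shiftQuad T μ φ - 2 * (inner ℂ g (φ : H)).re
  have hJ : ∀ φ, J φ = shiftQuad T μ φ - 2 * (inner ℂ g (φ : H)).re := fun φ => rfl
  have hbdd : BddBelow (Set.range J) := by
    refine ⟨-(‖g‖ ^ 2 / (μ + c)), ?_⟩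
    rintro _ ⟨φ, rfl⟩
    have h1 := hlow φ
    have h2 : (inner ℂ g (φ : H)).re ≤ ‖g‖ * ‖(φ : H)‖ :=
      (Complex.re_le_norm _).trans (norm_inner_le_norm _ _)
    have h3 : 0 ≤ ((μ + c) * ‖(φ : H)‖ - ‖g‖) ^ 2 / (μ + c) := by positivity
    have h4 : ((μ + c) * ‖(φ : H)‖ - ‖g‖) ^ 2 / (μ + c)
        = (μ + c) * ‖(φ : H)‖ ^ 2 - 2 * (‖g‖ * ‖(φ : H)‖) + ‖g‖ ^ 2 / (μ + c) := by
      field_simp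
      ring
    rw [hJ]
    linarith
  set m := ⨅ φ, J φ with hm
  have hmJ : ∀ φ, m ≤ J φ := fun φ => ciInf_le hbdd φ
  have hex : ∀ k : ℕ, ∃ φ, J φ < m + 1 / ((k : ℝ) + 1) := fun k =>
    exists_lt_of_ciInf_lt (lt_add_of_pos_right m (by positivity))
  choose u hu using hex
  -- Parallelogram identity: the linear terms cancel, and `J` at the midpoint is at least `m`, so a
  -- minimizing sequence is Cauchy for the form.
  have hpar : ∀ k l, shiftQuad T μ (u k - u l)
      ≤ 2 * (1 / ((k : ℝ) + 1)) + 2 * (1 / ((l : ℝ) + 1)) := by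
    intro k l
    have e : shiftQuad T μ (u k - u l)
        = 2 * J (u k) + 2 * J (u l) - 4 * J ((1 / 2 : ℂ) • (u k + u l)) := by
      have e1 : shiftQuad T μ ((1 / 2 : ℂ) • (u k + u l)) = shiftQuad T μ (u k + u l) / 4 := by
        have := shiftQuad_add_smul (μ := μ) hs 0 (u k + u l) (1 / 2)
        rw [zero_add] at this
        rw [this]
        simp [shiftQuad]
        ring
      have e2 : (inner ℂ g (((1 / 2 : ℂ) • (u k + u l) : T.domain) : H)).re
          = ((inner ℂ g (u k : H)).re + (inner ℂ g (u l : H)).re) / 2 := by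
        rw [Submodule.coe_smul, Submodule.coe_add, inner_smul_right, inner_add_right,
          show (1 / 2 : ℂ) = ((1 / 2 : ℝ) : ℂ) by norm_num, Complex.re_ofReal_mul, Complex.add_re]
        ring
      have e3 : shiftQuad T μ (u k + u l) + shiftQuad T μ (u k - u l)
          = 2 * shiftQuad T μ (u k) + 2 * shiftQuad T μ (u l) := by
        simp only [shiftQuad, map_add, map_sub, Submodule.coe_add,
          Submodule.coe_sub, inner_add_left, inner_add_right, inner_sub_left, inner_sub_right,
          Complex.add_re, Complex.sub_re]
        ring
      rw [hJ, hJ, hJ, e1, e2]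
      linarith
    linarith [hu k, hu l, hmJ ((1 / 2 : ℂ) • (u k + u l))]
  have hlim : Tendsto (fun p : ℕ × ℕ => shiftQuad T μ (u p.1 - u p.2)) atTop (𝓝 0) := by
    have h0 : Tendsto (fun k : ℕ => 2 * (1 / ((k : ℝ) + 1))) atTop (𝓝 0) := by
      simpa using tendsto_one_div_add_atTop_nhds_zero_nat.const_mul (2 : ℝ)
    have h1 : Tendsto (fun p : ℕ × ℕ => 2 * (1 / ((p.1 : ℝ) + 1)) + 2 * (1 / ((p.2 : ℝ) + 1)))
        atTop (𝓝 0) := by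
      rw [← prod_atTop_atTop_eq]
      simpa using (h0.comp tendsto_fst).add (h0.comp tendsto_snd)
    exact squeeze_zero (fun p => hp _) (fun p => hpar _ _) h1
  have hnorm : Tendsto (fun p : ℕ × ℕ => ‖(u p.1 : H) - u p.2‖ ^ 2) atTop (𝓝 0) := by
    have h0 := hlim.const_mul (μ + c)⁻¹
    rw [mul_zero] at h0
    refine squeeze_zero (fun p => by positivity) (fun p => ?_) h0
    rw [inv_mul_eq_div, le_div_iff₀ hμ, mul_comm]
    exact hlow (u p.1 - u p.2)
  have hcau : CauchySeq fun n => (u n : H) := by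
    rw [cauchySeq_iff_tendsto_dist_atTop_0]
    have h0 := (Real.continuous_sqrt.tendsto _).comp hnorm
    rw [Real.sqrt_zero] at h0
    refine h0.congr fun p => ?_
    rw [Function.comp_apply, Real.sqrt_sq (norm_nonneg _), dist_eq_norm]
  obtain ⟨x, hx⟩ := cauchySeq_tendsto_of_complete hcau
  have hfc : FormConverges T u x := by
    refine ⟨hx, ?_⟩
    have h0 := hlim.sub (hnorm.const_mul μ)
    rw [mul_zero, sub_zero] at h0
    refine h0.congr fun p => ?_
    rw [shiftQuad_eq]
    simp
  have hvar : ∀ ψ : T.domain, inner ℂ x (shift T μ ψ) = inner ℂ g (ψ : H) := by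
    intro ψ
    -- Quantitative Euler–Lagrange equation. Moving `u k` by `-s conj ζ` along `ψ`, with `s = 1 /
    -- (shiftQuad T μ ψ + 1)`, lowers `J` by at least `s ‖ζ‖²`, but `u k` is within `1 / (k + 1)` of
    -- the infimum.
    have hζ : ∀ k, ‖inner ℂ (u k : H) (shift T μ ψ) - inner ℂ g (ψ : H)‖ ^ 2
        ≤ (shiftQuad T μ ψ + 1) * (1 / ((k : ℝ) + 1)) := by
      intro k
      set ζ := inner ℂ (u k : H) (shift T μ ψ) - inner ℂ g (ψ : H) with hζ
      have hq := hp ψ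
      set s : ℝ := (shiftQuad T μ ψ + 1)⁻¹ with hsdef
      have hspos : 0 < s := by positivity
      have hs1 : s * (shiftQuad T μ ψ + 1) = 1 := inv_mul_cancel₀ (by positivity)
      have h1 := hmJ (u k + (-(s : ℂ) * (starRingEnd ℂ) ζ) • ψ)
      have e : J (u k + (-(s : ℂ) * (starRingEnd ℂ) ζ) • ψ)
          = J (u k) - 2 * s * ‖ζ‖ ^ 2 + s ^ 2 * ‖ζ‖ ^ 2 * shiftQuad T μ ψ := by
        rw [hJ, hJ, shiftQuad_add_smul hs, Submodule.coe_add, Submodule.coe_smul, inner_add_right,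
          inner_smul_right, Complex.add_re, inner_shift_left hs]
        have e1 : ((-(s : ℂ) * (starRingEnd ℂ) ζ) * inner ℂ (u k : H) (shift T μ ψ)).re
            - ((-(s : ℂ) * (starRingEnd ℂ) ζ) * inner ℂ g (ψ : H)).re = - s * ‖ζ‖ ^ 2 := by
          rw [← Complex.sub_re, ← mul_sub, ← hζ, mul_assoc, ← Complex.normSq_eq_conj_mul_self,
            Complex.normSq_eq_norm_sq, ← Complex.ofReal_neg, ← Complex.ofReal_mul,
            Complex.ofReal_re]
        have e2 : ‖-(s : ℂ) * (starRingEnd ℂ) ζ‖ ^ 2 = s ^ 2 * ‖ζ‖ ^ 2 := by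
          rw [norm_mul, norm_neg, RCLike.norm_conj, Complex.norm_real, Real.norm_eq_abs, mul_pow,
            sq_abs]
        rw [e2]
        linarith
      rw [e] at h1
      have h2 := hu k
      have h3 : s ^ 2 * ‖ζ‖ ^ 2 * shiftQuad T μ ψ = s * ‖ζ‖ ^ 2 - s ^ 2 * ‖ζ‖ ^ 2 := by
        linear_combination (s * ‖ζ‖ ^ 2) * hs1
      have h4 : 0 ≤ s ^ 2 * ‖ζ‖ ^ 2 := by positivity
      have h5 : s * ‖ζ‖ ^ 2 ≤ 1 / ((k : ℝ) + 1) := by linarith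
      calc ‖ζ‖ ^ 2 = (shiftQuad T μ ψ + 1) * (s * ‖ζ‖ ^ 2) := by
            linear_combination (- ‖ζ‖ ^ 2) * hs1
        _ ≤ _ := by gcongr
    have hlim0 : Tendsto (fun k => ‖inner ℂ (u k : H) (shift T μ ψ) - inner ℂ g (ψ : H)‖ ^ 2)
        atTop (𝓝 0) := by
      refine squeeze_zero (fun k => by positivity) hζ ?_
      simpa using tendsto_one_div_add_atTop_nhds_zero_nat.const_mul (shiftQuad T μ ψ + 1)
    have hlim1 := (((hx.inner (tendsto_const_nhds (x := shift T μ ψ))).sub_const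
      (inner ℂ g (ψ : H))).norm.pow 2)
    have := tendsto_nhds_unique hlim1 hlim0
    exact sub_eq_zero.1 (norm_eq_zero.1 (pow_eq_zero_iff (two_ne_zero)|>.1 this))
  have hadj : ∀ ψ : T.domain, inner ℂ (g - (μ : ℂ) • x) (ψ : H) = inner ℂ x (T ψ) := by
    intro ψ
    have h := hvar ψ
    rw [shift_apply, inner_add_right, inner_smul_right] at h
    rw [inner_sub_left, inner_smul_left, Complex.conj_ofReal, ← h]
    ring
  have hxd : x ∈ T†.domain := LinearPMap.mem_adjoint_domain_of_exists x ⟨_, hadj⟩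
  refine ⟨⟨x, hxd⟩, ⟨u, hfc⟩, ?_⟩
  rw [LinearPMap.adjoint_apply_eq hd ⟨x, hxd⟩ hadj]
  simp

/-- A symmetric operator `F` with `F + μ` onto for some real `μ` is self-adjoint: for `y ∈ dom F†`
one solves `(F + μ) x = (F† + μ) y`, and then `y - x` is orthogonal to the range of `F + μ`. -/
theorem isSelfAdjoint_friedrichs (hd : Dense (T.domain : Set H))
    (hs : T.IsFormalAdjoint T) (hT : IsSemibounded T) : IsSelfAdjoint (friedrichs T hT) := by
  have hFd : Dense ((friedrichs T hT).domain : Set H) :=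
    hd.mono (domain_le_friedrichs_domain hd hs hT)
  have hFs := isFormalAdjoint_friedrichs hd hs hT
  refine isSelfAdjoint_of_adjoint_domain_le hFd hFs fun y hy => ?_
  obtain ⟨c, hc⟩ := id hT
  have hμ : 0 < (1 - c) + c := by simp
  obtain ⟨x, hx, e⟩ := exists_adjoint_add_smul_eq hd hs hT hc hμ
    ((friedrichs T hT)† ⟨y, hy⟩ + ((1 - c : ℝ) : ℂ) • y)
  have hxF : (x : H) ∈ (friedrichs T hT).domain := ⟨hx, x.2⟩
  have eF : friedrichs T hT ⟨x, hxF⟩ = T† x := rfl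
  -- Surjectivity is used again to write `y - x = (F + μ) v`, turning the orthogonality into `‖y -
  -- x‖² = 0`.
  obtain ⟨v, hv, e'⟩ := exists_adjoint_add_smul_eq hd hs hT hc hμ (y - x)
  have hvF : (v : H) ∈ (friedrichs T hT).domain := ⟨hv, v.2⟩
  have eF' : friedrichs T hT ⟨v, hvF⟩ = T† v := rfl
  have h1 := LinearPMap.adjoint_isFormalAdjoint hFd ⟨y, hy⟩ ⟨v, hvF⟩
  have h2 := hFs ⟨x, hxF⟩ ⟨v, hvF⟩
  have h3 : inner ℂ (y - x) (y - (x : H)) = 0 := by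
    nth_rewrite 2 [← e']
    have h4 := congrArg (fun w => inner ℂ w (v : H)) e
    simp only [inner_add_left, inner_smul_left, Complex.conj_ofReal] at h4
    rw [eF'] at h1 h2
    rw [eF] at h2
    simp only [inner_add_right, inner_sub_left, inner_smul_right]
    change inner ℂ (T† x) (v : H) = inner ℂ (x : H) (T† v) at h2
    change _ = inner ℂ y (T† v) at h1
    change _ = inner ℂ ((friedrichs T hT)† ⟨y, hy⟩) (v : H) + _ at h4
    linear_combination h2 - h1 - h4
  rw [inner_self_eq_zero, sub_eq_zero] at h3
  rw [h3]
  exact hxF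

end

/-! ### Defect spaces, and extensions compared with the Friedrichs extension -/

section

variable {H : Type*} [NormedAddCommGroup H] [InnerProductSpace ℂ H]

theorem mem_kerSub_iff {T : H →ₗ.[ℂ] H} {z : ℂ} {h : H} :
    h ∈ kerSub T z ↔ ∃ hh : h ∈ T.domain, T ⟨h, hh⟩ = z • h := by
  constructor
  · rintro ⟨x, hx, rfl⟩
    exact ⟨x.2, sub_eq_zero.1 hx⟩
  · rintro ⟨hh, e⟩
    exact ⟨⟨h, hh⟩, sub_eq_zero.2 e, rfl⟩

/-- Monotone sequences of positive operators whose forms are unbounded at every nonzero vector of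
a finite-dimensional subspace grow uniformly on that subspace. -/
theorem exists_forall_mul_norm_sq_le {W : ℕ → H →L[ℂ] H} (hmono : Monotone W)
    (N : Submodule ℂ H) [FiniteDimensional ℂ N]
    (hN : ∀ h ∈ N, h ≠ 0 → ¬ BddAbove (Set.range fun n => (inner ℂ (W n h) h).re)) (M : ℝ) :
    ∃ n₀, ∀ n ≥ n₀, ∀ h ∈ N, M * ‖h‖ ^ 2 ≤ (inner ℂ (W n h) h).re := by
  have hm : ∀ m n, m ≤ n → ∀ h, (inner ℂ (W m h) h).re ≤ (inner ℂ (W n h) h).re := by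
    intro m n hmn h
    have := ((ContinuousLinearMap.le_def _ _).1 (hmono hmn)).re_inner_nonneg_left h
    rw [sub_apply, inner_sub_left] at this
    simpa using this
  have : ProperSpace N := FiniteDimensional.proper ℂ N
  -- The sets where the form of `W n` exceeds `M` are open, increase with `n` and cover the unit
  -- sphere of `N`; by compactness a single one covers it.
  obtain ⟨n₀, hn₀⟩ := (isCompact_sphere (0 : N) 1).elim_directed_cover
    (fun n => {h : N | M < (inner ℂ (W n h) (h : H)).re})
    (fun n => isOpen_lt continuous_const (by fun_prop))
    (fun h hh => by
      have h0 : (h : H) ≠ 0 := by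
        intro h0
        rw [mem_sphere_zero_iff_norm, Submodule.coe_norm, h0, norm_zero] at hh
        exact zero_ne_one hh
      obtain ⟨_, ⟨n, rfl⟩, hn⟩ := not_bddAbove_iff.1 (hN h h.2 h0) M
      exact Set.mem_iUnion.2 ⟨n, hn⟩)
    (directed_of_isDirected_le fun m n hmn h hh => lt_of_lt_of_le hh (hm m n hmn h))
  refine ⟨n₀, fun n hn h hh => ?_⟩
  rcases eq_or_ne h 0 with rfl | h0
  · simp
  have hpos : 0 < ‖h‖ := norm_pos_iff.2 h0
  let e : N := ((‖h‖⁻¹ : ℝ) : ℂ) • ⟨h, hh⟩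
  have he : e ∈ Metric.sphere (0 : N) 1 := by
    rw [mem_sphere_zero_iff_norm, norm_smul, Complex.norm_real, norm_inv, norm_norm]
    exact inv_mul_cancel₀ hpos.ne'
  have h1 : M < (inner ℂ (W n₀ e) (e : H)).re := hn₀ he
  have h2 : (inner ℂ (W n₀ e) (e : H)).re = (‖h‖ ^ 2)⁻¹ * (inner ℂ (W n₀ h) h).re := by
    change (inner ℂ (W n₀ (((‖h‖⁻¹ : ℝ) : ℂ) • h)) (((‖h‖⁻¹ : ℝ) : ℂ) • h)).re = _
    rw [map_smul, inner_smul_left, inner_smul_right, Complex.conj_ofReal, Complex.re_ofReal_mul,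
      Complex.re_ofReal_mul, ← mul_assoc, sq, mul_inv]
  rw [h2, inv_mul_eq_div, lt_div_iff₀ (by positivity)] at h1
  exact h1.le.trans (hm _ _ hn h)

variable {T : H →ₗ.[ℂ] H}

theorem IsFormalAdjoint.of_le {B : H →ₗ.[ℂ] H} (hB : B.IsFormalAdjoint B) (h : T ≤ B) :
    T.IsFormalAdjoint T := fun x y => by
  rw [h.2 (y := ⟨x, h.1 x.2⟩) rfl, h.2 (x := y) (y := ⟨y, h.1 y.2⟩) rfl]
  exact hB ⟨x, h.1 x.2⟩ ⟨y, h.1 y.2⟩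

theorem quad_of_le {B : H →ₗ.[ℂ] H} (h : T ≤ B) (x : T.domain) :
    quad T x = quad B ⟨x, h.1 x.2⟩ := by
  rw [quad, h.2 (y := ⟨x, h.1 x.2⟩) rfl, quad]

variable [CompleteSpace H]

theorem le_adjoint_of_le (hd : Dense (T.domain : Set H)) {B : H →ₗ.[ℂ] H}
    (hB : B.IsFormalAdjoint B) (h : T ≤ B) : B ≤ T† :=
  LinearPMap.IsFormalAdjoint.le_adjoint hd fun x y => by
    rw [h.2 (y := ⟨x, h.1 x.2⟩) rfl]
    exact hB ⟨x, h.1 x.2⟩ y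

/-- If `T` has a nonnegative self-adjoint extension, the defect spaces at negative points embed
into the one at `i`. -/
theorem finiteDimensional_kerSub_adjoint (hd : Dense (T.domain : Set H)) {A : H →ₗ.[ℂ] H}
    (hA : IsNonnegSelfAdjoint A) (hTA : T ≤ A) {η : ℝ} (hη : η < 0)
    [FiniteDimensional ℂ (kerSub T† Complex.I)] : FiniteDimensional ℂ (kerSub T† (η : ℂ)) := by
  have hle := le_adjoint_of_le hd (isFormalAdjoint_of_isSelfAdjoint hA.1) hTA
  obtain ⟨R, hR⟩ := exists_isResolvent_of_isSelfAdjoint hA.1 (z := Complex.I) (by simp)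
  -- `P = (A - η)(A - i)⁻¹`. A vector of the defect space killed by `P` lies in `dom A`, hence is an
  -- eigenvector of `A ≥ 0` at `η < 0`, so it vanishes.
  let P : H →ₗ[ℂ] H := LinearMap.id + (Complex.I - (η : ℂ)) • (R : H →ₗ[ℂ] H)
  have hPa : ∀ h, P h = h + (Complex.I - (η : ℂ)) • R h := fun h => rfl
  have hP : ∀ h ∈ kerSub T† (η : ℂ), P h ∈ kerSub T† Complex.I := by
    intro h hh
    obtain ⟨hd1, e1⟩ := mem_kerSub_iff.1 hh
    obtain ⟨hd2, e2⟩ := hR.1 h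
    have e3 : T† ⟨R h, hle.1 hd2⟩ = h + Complex.I • R h := by
      rw [← hle.2 (x := ⟨R h, hd2⟩) rfl]
      exact sub_eq_iff_eq_add.1 e2
    rw [mem_kerSub_iff]
    refine ⟨add_mem hd1 (Submodule.smul_mem _ _ (hle.1 hd2)), ?_⟩
    have : (⟨P h, add_mem hd1 (Submodule.smul_mem _ _ (hle.1 hd2))⟩ : T†.domain)
        = ⟨h, hd1⟩ + (Complex.I - (η : ℂ)) • ⟨R h, hle.1 hd2⟩ := rfl
    rw [this, LinearPMap.map_add, LinearPMap.map_smul, e1, e3, hPa]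
    module
  have hinj : Function.Injective (P.restrict hP) := by
    rw [injective_iff_map_eq_zero]
    rintro ⟨h, hh⟩ h0
    have h0' : h + (Complex.I - (η : ℂ)) • R h = 0 := congrArg Subtype.val h0
    obtain ⟨hd1, e1⟩ := mem_kerSub_iff.1 hh
    have hdA : h ∈ A.domain := by
      rw [eq_neg_of_add_eq_zero_left h0']
      exact neg_mem (Submodule.smul_mem _ _ (hR.1 h).1)
    have hq := hA.2 ⟨h, hdA⟩
    rw [quad, hle.2 (x := ⟨h, hdA⟩) (y := ⟨h, hd1⟩) rfl, e1, inner_smul_left, Complex.conj_ofReal,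
      Complex.re_ofReal_mul, inner_self_eq_norm_sq_to_K] at hq
    have hq' : 0 ≤ η * ‖h‖ ^ 2 := by simpa [← Complex.ofReal_pow] using hq
    have : ‖h‖ ^ 2 ≤ 0 := by
      by_contra hc
      nlinarith
    have hn : ‖h‖ = 0 := by nlinarith [norm_nonneg h]
    exact Subtype.ext (norm_eq_zero.1 hn)
  exact FiniteDimensional.of_injective _ hinj

/-- Von Neumann type decomposition with respect to the Friedrichs extension. -/
theorem exists_decomposition (hd : Dense (T.domain : Set H)) (hs : T.IsFormalAdjoint T)
    (hT : IsSemibounded T) {c η : ℝ} (hc : ∀ x : T.domain, c * ‖(x : H)‖ ^ 2 ≤ quad T x)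
    (hη : η < c) (u : T†.domain) :
    ∃ x : T†.domain, (x : H) ∈ formDomain T hT ∧ (u : H) - x ∈ kerSub T† (η : ℂ) ∧
      T† x - (η : ℂ) • (x : H) = T† u - (η : ℂ) • (u : H) := by
  obtain ⟨x, hx, e⟩ := exists_adjoint_add_smul_eq (μ := -η) hd hs hT hc (by linarith)
    (T† u - (η : ℂ) • (u : H))
  have e' : T† x - (η : ℂ) • (x : H) = T† u - (η : ℂ) • (u : H) := by
    rw [← e, Complex.ofReal_neg, neg_smul, sub_eq_add_neg]
  refine ⟨x, hx, mem_kerSub_iff.2 ⟨sub_mem u.2 x.2, ?_⟩, e'⟩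
  have h : (⟨(u : H) - x, sub_mem u.2 x.2⟩ : T†.domain) = u - x := rfl
  rw [h, LinearPMap.map_sub, smul_sub]
  rw [sub_eq_sub_iff_add_eq_add] at e' ⊢
  rw [← e', add_comm]

/-- For a self-adjoint extension `At` of `T` and `u = x + h` in its domain, with `x` in the domain
of the Friedrichs extension and `h` in the finite-dimensional defect space, `((At - η) u, h)` is
controlled by `h` alone. -/
theorem exists_norm_inner_defect_le (hd : Dense (T.domain : Set H)) (hs : T.IsFormalAdjoint T)
    (hT : IsSemibounded T) {η : ℝ} [FiniteDimensional ℂ (kerSub T† (η : ℂ))]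
    {At : H →ₗ.[ℂ] H} (hAt : At.IsFormalAdjoint At) (hTA : T ≤ At) :
    ∃ C, 0 ≤ C ∧ ∀ (u : At.domain) (h : H), h ∈ kerSub T† (η : ℂ) →
      (u : H) - h ∈ (friedrichs T hT).domain →
      ‖inner ℂ (At u - (η : ℂ) • (u : H)) h‖ ≤ C * ‖h‖ ^ 2 := by
  have hle := le_adjoint_of_le hd hAt hTA
  have hF := isFormalAdjoint_friedrichs hd hs hT
  let K : At.domain →ₗ[ℂ] H := At.toFun - (η : ℂ) • At.domain.subtype
  have hK : ∀ u : At.domain, K u = At u - (η : ℂ) • (u : H) := fun u => rfl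
  -- Both extensions are restrictions of `T†`, and `T† - η` annihilates `h`.
  have hKF : ∀ (u : At.domain) (h : H), h ∈ kerSub T† (η : ℂ) →
      ∀ hu : (u : H) - h ∈ (friedrichs T hT).domain,
      K u = friedrichs T hT ⟨(u : H) - h, hu⟩ - (η : ℂ) • ((u : H) - h) := by
    intro u h hh hu
    obtain ⟨hd1, e1⟩ := mem_kerSub_iff.1 hh
    have e2 : friedrichs T hT ⟨(u : H) - h, hu⟩ = T† (⟨u, hle.1 u.2⟩ - ⟨h, hd1⟩) := rfl
    rw [hK, e2, LinearPMap.map_sub, e1, ← hle.2 (x := u) rfl]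
    module
  -- For `v` in both domains, symmetry of `At` gives `(K v, u) = (v, K u)`, while symmetry of the
  -- Friedrichs extension gives `(K v, u - h) = (v, K u)`; subtract.
  have horth : ∀ (v u : At.domain) (h : H), (v : H) ∈ (friedrichs T hT).domain →
      h ∈ kerSub T† (η : ℂ) → (u : H) - h ∈ (friedrichs T hT).domain →
      inner ℂ (K v) h = 0 := by
    intro v u h hv hh hu
    have hv' : (v : H) - 0 ∈ (friedrichs T hT).domain := by rwa [sub_zero]
    have e1 := IsFormalAdjoint.inner_sub_smul hAt (η : ℂ) v u
    have e2 := IsFormalAdjoint.inner_sub_smul hF (η : ℂ) ⟨(v : H) - 0, hv'⟩ ⟨(u : H) - h, hu⟩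
    dsimp only at e2
    rw [Complex.conj_ofReal] at e1 e2
    rw [← hKF v 0 (zero_mem _) hv', ← hKF u h hh hu] at e2
    rw [← hK, ← hK] at e1
    rw [sub_zero, ← e1, inner_sub_right] at e2
    simpa using e2
  -- Pairs `(u, h)` with `u - h` in the Friedrichs domain. By `horth`, `(K u, h)` depends on `h`
  -- alone, so `u` may be replaced by a linear choice `s` over the occurring `h`; `K` after this
  -- choice is linear on a finite-dimensional space, hence bounded.
  let L : Submodule ℂ (At.domain × kerSub T† (η : ℂ)) :=
    (friedrichs T hT).domain.comap
      (At.domain.subtype.comp (LinearMap.fst ℂ _ _)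
        - (kerSub T† (η : ℂ)).subtype.comp (LinearMap.snd ℂ _ _))
  have hL : ∀ p, p ∈ L ↔ (p.1 : H) - p.2 ∈ (friedrichs T hT).domain := fun p => Iff.rfl
  let q : L →ₗ[ℂ] kerSub T† (η : ℂ) := (LinearMap.snd ℂ _ _).comp L.subtype
  obtain ⟨s, hs'⟩ := q.rangeRestrict.exists_rightInverse_of_surjective q.range_rangeRestrict
  let G : LinearMap.range q →ₗ[ℂ] H :=
    K.comp ((LinearMap.fst ℂ _ _).comp (L.subtype.comp s))
  have hG : ∀ r, G r = K (s r).1.1 := fun r => rfl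
  have hsec : ∀ r, (s r).1.2 = r.1 := fun r => congrArg Subtype.val (LinearMap.congr_fun hs' r)
  let Gc := LinearMap.toContinuousLinearMap G
  refine ⟨‖Gc‖, Gc.opNorm_nonneg, fun u h hh hu => ?_⟩
  let p : L := ⟨(u, ⟨h, hh⟩), hu⟩
  let r : LinearMap.range q := ⟨⟨h, hh⟩, ⟨p, rfl⟩⟩
  have hdiff : ((u - (s r).1.1 : At.domain) : H) ∈ (friedrichs T hT).domain := by
    have h1 := (hL _).1 (s r).2
    rw [hsec] at h1
    have h2 := sub_mem hu h1
    rwa [sub_sub_sub_cancel_right] at h2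
  have h0 := horth _ u h hdiff hh hu
  rw [map_sub, inner_sub_left, sub_eq_zero] at h0
  rw [← hK, h0, ← hG]
  calc ‖inner ℂ (G r) h‖ ≤ ‖G r‖ * ‖h‖ := norm_inner_le_norm _ _
    _ ≤ ‖Gc‖ * ‖r‖ * ‖h‖ := by
      gcongr
      exact Gc.le_opNorm r
    _ = ‖Gc‖ * ‖h‖ ^ 2 := by
      rw [sq, ← mul_assoc]
      rfl

theorem FormConverges.tendsto_quad (hd : Dense (T.domain : Set H)) (hs : T.IsFormalAdjoint T)
    (h0 : ∀ x, 0 ≤ quad T x) {u : ℕ → T.domain} {x : T†.domain} (hu : FormConverges T u x) :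
    Tendsto (fun k => quad T (u k)) atTop (𝓝 (quad T† x)) := by
  have h := hu.tendsto_shiftQuad (μ := 0) hd hs (fun x => by simpa [shiftQuad_eq] using h0 x)
  simpa [shiftQuad_eq, quad] using h

theorem quad_adjoint_nonneg (hd : Dense (T.domain : Set H)) (hs : T.IsFormalAdjoint T)
    (h0 : ∀ x, 0 ≤ quad T x) (hT : IsSemibounded T) {x : T†.domain}
    (hx : (x : H) ∈ formDomain T hT) : 0 ≤ quad T† x := by
  obtain ⟨u, hu⟩ := hx
  exact ge_of_tendsto' (hu.tendsto_quad hd hs h0) fun k => h0 _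

/-- A form bound for a bounded operator extends to the domain of the Friedrichs extension. -/
theorem inner_le_of_mem_formDomain (hd : Dense (T.domain : Set H)) (hs : T.IsFormalAdjoint T)
    (h0 : ∀ x, 0 ≤ quad T x) (hT : IsSemibounded T) {a b : ℝ} {B : H →L[ℂ] H}
    (hB : ∀ x : T.domain, (inner ℂ (B x) (x : H)).re ≤ a * quad T x + b * ‖(x : H)‖ ^ 2)
    {x : T†.domain} (hx : (x : H) ∈ formDomain T hT) :
    (inner ℂ (B x) (x : H)).re ≤ a * quad T† x + b * ‖(x : H)‖ ^ 2 := by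
  obtain ⟨u, hu⟩ := hx
  refine le_of_tendsto_of_tendsto' ((Complex.continuous_re.tendsto _).comp
    (((B.continuous.tendsto _).comp hu.1).inner hu.1))
    (((hu.tendsto_quad hd hs h0).const_mul a).add ((hu.1.norm.pow 2).const_mul b)) fun k => hB _

end

/-! ### A priori bounds and limits of the regularized forms -/

section

variable {H : Type*} [NormedAddCommGroup H] [InnerProductSpace ℂ H]

/-- Testing a symmetric operator at `x + h` with `x - h`. -/
theorem re_inner_add_sub {B : H →L[ℂ] H} (hB : ∀ x y, inner ℂ (B x) y = inner ℂ x (B y))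
    (α : ℝ) (x h r : H) :
    (inner ℂ ((α : ℂ) • B (x + h) + r) (x - h)).re
      = α * ((inner ℂ (B x) x).re - (inner ℂ (B h) h).re) + (inner ℂ r (x - h)).re := by
  have h1 : (inner ℂ (B x) h).re = (inner ℂ (B h) x).re := by
    rw [hB, ← Complex.conj_re, inner_conj_symm]
  rw [inner_add_left, Complex.add_re, inner_smul_left, Complex.conj_ofReal, Complex.re_ofReal_mul,
    map_add, inner_add_left, inner_sub_right, inner_sub_right, Complex.add_re, Complex.sub_re,
    Complex.sub_re, h1]
  ring

/-- Here `t`, `X` are the form and norm of `x`, `y = ‖h‖`, `p` and `q` are the forms of `W n` at `x`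
and `h`, `θ` is the boundary term and `s` the remainder. The coefficient of `y ^ 2` to be absorbed
is `2 * α * b + Θ + 1`: from `X ^ 2 ≤ 2 * U ^ 2 + 2 * y ^ 2`, from `θ`, and from `2 * ρ * y ≤ ρ ^ 2
+ y ^ 2`. The bound `hq` makes half of `α * q` absorb it. -/
theorem bounds_of_energy_identity {t X y p q θ s a b α η Θ U ρ : ℝ} (hb : 0 < b) (hα : 0 < α)
    (hαa : α * a < 1) (hη : η < 0) (hΘ : 0 ≤ Θ) (ht : 0 ≤ t)
    (hX : 0 ≤ X) (hXy : X ≤ U + y) (hp : p ≤ a * t + b * X ^ 2)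
    (hq : 2 * (2 * α * b + Θ + 1) / α * y ^ 2 ≤ q) (hθ : θ ≤ Θ * y ^ 2)
    (hs : s ≤ ρ * (U + 2 * y)) (he : t - η * X ^ 2 - θ = α * (p - q) + s) :
    t ≤ (2 * α * b * U ^ 2 + ρ * U + ρ ^ 2) / (1 - α * a) ∧
      X ^ 2 ≤ 2 * U ^ 2 + 2 * (2 * α * b * U ^ 2 + ρ * U + ρ ^ 2) ∧
      q ≤ 2 * (2 * α * b * U ^ 2 + ρ * U + ρ ^ 2) / α := by
  have hδ : 0 < 1 - α * a := by linarith
  have hs' : ρ * (U + 2 * y) ≤ ρ * U + ρ ^ 2 + y ^ 2 := by nlinarith [sq_nonneg (ρ - y)]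
  have hX2 : X ^ 2 ≤ 2 * U ^ 2 + 2 * y ^ 2 := by
    have h1 : X ^ 2 ≤ (U + y) ^ 2 := by gcongr
    nlinarith [sq_nonneg (U - y)]
  have hηX : 0 ≤ -η * X ^ 2 := mul_nonneg (by linarith) (sq_nonneg _)
  have hαp := mul_le_mul_of_nonneg_left hp hα.le
  have hαbX := mul_le_mul_of_nonneg_left hX2 (mul_pos hα hb).le
  have hαq : 2 * (2 * α * b + Θ + 1) * y ^ 2 ≤ α * q := by
    have h1 := mul_le_mul_of_nonneg_left hq hα.le
    have h2 : α * (2 * (2 * α * b + Θ + 1) / α * y ^ 2)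
        = 2 * (2 * α * b + Θ + 1) * y ^ 2 := by field_simp
    linarith
  have hmain : (1 - α * a) * t + α * q
      ≤ (2 * α * b + Θ + 1) * y ^ 2 + (2 * α * b * U ^ 2 + ρ * U + ρ ^ 2) := by linarith
  have h1 : 0 ≤ (2 * α * b + Θ) * y ^ 2 := by positivity
  have h2 : 0 ≤ y ^ 2 := sq_nonneg y
  have h3 : 0 ≤ (1 - α * a) * t := by positivity
  refine ⟨?_, by linarith, ?_⟩
  · rw [le_div_iff₀ hδ, mul_comm]
    linarith
  · rw [le_div_iff₀ hα, mul_comm]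
    linarith

variable [CompleteSpace H]
variable {T V : H →ₗ.[ℂ] H}

/-- A priori bound for the solutions of `(At - α W n - z) u = f` with `‖u‖ ≤ U`, from testing the
equation with `x - h`, where `u = x + h` is the decomposition along the Friedrichs extension. -/
theorem exists_eventually_decomposition_bounded (hd : Dense (T.domain : Set H))
    (hs : T.IsFormalAdjoint T) (h0 : ∀ x, 0 ≤ quad T x) (hT : IsSemibounded T)
    {W : ℕ → H →L[ℂ] H} (hpos : ∀ n, (W n).IsPositive) (hmono : Monotone W)
    {a b α η : ℝ} (hb : 0 < b) (hα : 0 < α) (hαa : α * a < 1) (hη : η < 0)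
    (hW : ∀ n, ∀ x : T.domain,
      (inner ℂ (W n x) (x : H)).re ≤ a * quad T x + b * ‖(x : H)‖ ^ 2)
    [FiniteDimensional ℂ (kerSub T† (η : ℂ))]
    (hadm : ∀ h ∈ kerSub T† (η : ℂ), h ≠ 0 →
      ¬ BddAbove (Set.range fun n => (inner ℂ (W n h) h).re))
    {At : H →ₗ.[ℂ] H} (hAt : At.IsFormalAdjoint At) (hTA : T ≤ At) (z : ℂ) (f : H)
    {U : ℝ} (hU : 0 ≤ U) :
    ∃ C, 0 ≤ C ∧ ∀ᶠ n in atTop, ∀ u : At.domain, ‖(u : H)‖ ≤ U →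
      subBounded At ((α : ℂ) • W n) u - z • (u : H) = f →
      ∃ x : T†.domain, (x : H) ∈ formDomain T hT ∧ (u : H) - x ∈ kerSub T† (η : ℂ) ∧
        quad T† x ≤ C ∧ ‖(x : H)‖ ^ 2 ≤ C ∧
        (inner ℂ (W n ((u : H) - x)) ((u : H) - x)).re ≤ C := by
  have hle := le_adjoint_of_le hd hAt hTA
  obtain ⟨Θ, hΘ, hΘb⟩ := exists_norm_inner_defect_le (η := η) hd hs hT hAt hTA
  obtain ⟨n₀, hn₀⟩ := exists_forall_mul_norm_sq_le hmono _ hadm (2 * (2 * α * b + Θ + 1) / α)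
  obtain ⟨ρ, hρ⟩ : ∃ ρ, ρ = ‖f‖ + ‖z - (η : ℂ)‖ * U := ⟨_, rfl⟩
  have hρ0 : 0 ≤ ρ := by rw [hρ]; positivity
  have hδ : 0 < 1 - α * a := by linarith
  have p1 : 0 ≤ (2 * α * b * U ^ 2 + ρ * U + ρ ^ 2) / (1 - α * a) := by positivity
  have p2 : 0 ≤ 2 * U ^ 2 + 2 * (2 * α * b * U ^ 2 + ρ * U + ρ ^ 2) := by positivity
  have p3 : 0 ≤ 2 * (2 * α * b * U ^ 2 + ρ * U + ρ ^ 2) / α := by positivity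
  refine ⟨_, add_nonneg (add_nonneg p1 p2) p3,
    eventually_atTop.2 ⟨n₀, fun n hn u hu hfu => ?_⟩⟩
  obtain ⟨x, hx, hh, e⟩ := exists_decomposition (c := 0) hd hs hT
    (fun x => by simpa using h0 x) hη ⟨u, hle.1 u.2⟩
  rw [← hle.2 (x := u) (y := ⟨u, hle.1 u.2⟩) rfl] at e
  refine ⟨x, hx, hh, ?_⟩
  have hθ := hΘb u _ hh (by
    rw [sub_sub_cancel]
    exact ⟨hx, x.2⟩)
  have hwh := hn₀ n hn _ hh
  dsimp only at e hθ hwh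
  obtain ⟨h, hdef⟩ : ∃ h, h = (u : H) - x := ⟨_, rfl⟩
  rw [← hdef] at hθ hwh ⊢
  have hux : (u : H) = x + h := by rw [hdef]; abel
  -- The equation with spectral point moved to `η`: `(At - η) u = α W n u + r`, where `‖r‖ ≤ ρ`.
  obtain ⟨r, hr⟩ : ∃ r, r = f + (z - (η : ℂ)) • (u : H) := ⟨_, rfl⟩
  have hrn : ‖r‖ ≤ ρ := by
    rw [hr, hρ]
    refine (norm_add_le _ _).trans ?_
    rw [norm_smul]
    gcongr
  have hxn : ‖(x : H)‖ ≤ U + ‖h‖ := by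
    have h1 : (x : H) = u - h := by rw [hdef]; abel
    rw [h1]
    exact (norm_sub_le _ _).trans (by linarith)
  have hxhn : ‖(x : H) - h‖ ≤ U + 2 * ‖h‖ := by
    have h1 := norm_sub_le ((u : H) - h) h
    have h2 := norm_sub_le (u : H) h
    have h3 : (x : H) - h = u - h - h := by rw [hdef]; abel
    rw [h3]
    linarith
  have hv : At u - (η : ℂ) • (u : H) = (α : ℂ) • W n (x + h) + r := by
    have h1 : At u - ((α : ℂ) • W n) u - z • (u : H) = f := hfu
    rw [hr, ← h1, smul_apply, ← hux]
    module
  have hvx : (inner ℂ (At u - (η : ℂ) • (u : H)) (x : H)).re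
      = quad T† x - η * ‖(x : H)‖ ^ 2 := by
    rw [← e, inner_sub_left, inner_smul_left, Complex.conj_ofReal, Complex.sub_re,
      Complex.re_ofReal_mul, inner_self_eq_norm_sq_to_K, quad]
    simp [← Complex.ofReal_pow]
  have hid := re_inner_add_sub (hpos n).inner_left_eq_inner_right α (x : H) h r
  rw [← hv, inner_sub_right, Complex.sub_re, hvx] at hid
  have hrr : (inner ℂ r ((x : H) - h)).re ≤ ρ * (U + 2 * ‖h‖) :=
    (Complex.re_le_norm _).trans ((norm_inner_le_norm _ _).trans
      (mul_le_mul hrn hxhn (norm_nonneg _) hρ0))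
  obtain ⟨q1, q2, q3⟩ := bounds_of_energy_identity hb hα hαa hη hΘ
    (quad_adjoint_nonneg hd hs h0 hT hx) (norm_nonneg _) hxn
    (inner_le_of_mem_formDomain hd hs h0 hT (hW n) hx) hwh
    ((Complex.re_le_norm _).trans hθ) hrr hid
  exact ⟨by linarith, by linarith, by linarith⟩

/-- If `h n → 0` and the energies `(W n (h n), h n)` stay bounded, then `(W n φ, h n) → 0`. -/
theorem tendsto_inner_regularizing {D : Submodule ℂ H} {W : ℕ → H →L[ℂ] H}
    (hW : IsRegularizing V D W) {h : ℕ → H} (hh : Tendsto h atTop (𝓝 0)) {C : ℝ}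
    (hC : ∀ᶠ n in atTop, (inner ℂ (W n (h n)) (h n)).re ≤ C) {φ : V.domain} (hφ : (φ : H) ∈ D) :
    Tendsto (fun n => inner ℂ (W n φ) (h n)) atTop (𝓝 0) := by
  -- Split `W n = W m + (W n - W m)` and apply Cauchy–Schwarz to the positive second part. Its form
  -- is at most `quad V φ - (W m φ, φ)` at `φ`, small for large `m`, and at most `C` at `h n`. So
  -- `m` is fixed first, then `n → ∞`.
  have key : ∀ m n, m ≤ n → (inner ℂ (W n (h n)) (h n)).re ≤ C →
      ‖inner ℂ (W n φ) (h n)‖ ≤ ‖inner ℂ (W m φ) (h n)‖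
        + √((quad V φ - (inner ℂ (W m φ) (φ : H)).re) * C) := by
    intro m n hmn hCn
    have hp := (ContinuousLinearMap.le_def _ _).1 (hW.mono hmn)
    have h1 := norm_inner_sq_le ((W n - W m : H →L[ℂ] H) : H →ₗ[ℂ] H) LinearMap.id
      (fun x y => hp.inner_left_eq_inner_right x y) (fun x => hp.re_inner_nonneg_left x)
      (φ : H) (h n)
    simp only [ContinuousLinearMap.coe_coe, LinearMap.id_apply] at h1
    have h2 : (inner ℂ ((W n - W m) φ) (φ : H)).re
        ≤ quad V φ - (inner ℂ (W m φ) (φ : H)).re := by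
      rw [sub_apply, inner_sub_left, Complex.sub_re]
      linarith [hW.le n φ]
    have h3 : (inner ℂ ((W n - W m) (h n)) (h n)).re ≤ C := by
      have h4 : 0 ≤ (inner ℂ (W m (h n)) (h n)).re := (hW.pos m).re_inner_nonneg_left (h n)
      rw [sub_apply, inner_sub_left, Complex.sub_re]
      linarith
    have h5 : 0 ≤ (inner ℂ ((W n - W m) (h n)) (h n)).re := hp.re_inner_nonneg_left (h n)
    have h6 : 0 ≤ (inner ℂ ((W n - W m) φ) (φ : H)).re := hp.re_inner_nonneg_left (φ : H)
    have h7 : ‖inner ℂ ((W n - W m) φ) (h n)‖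
        ≤ √((quad V φ - (inner ℂ (W m φ) (φ : H)).re) * C) :=
      Real.le_sqrt_of_sq_le (h1.trans (mul_le_mul h2 h3 h5 (h6.trans h2)))
    have h8 : inner ℂ (W n φ) (h n) = inner ℂ (W m φ) (h n) + inner ℂ ((W n - W m) φ) (h n) := by
      rw [← inner_add_left]
      simp
    rw [h8]
    exact (norm_add_le _ _).trans (by gcongr)
  have hlim : Tendsto (fun m => √((quad V φ - (inner ℂ (W m φ) (φ : H)).re) * C)) atTop (𝓝 0) := by
    have h1 := ((hW.tendsto φ hφ).const_sub (quad V φ)).mul_const C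
    rw [sub_self, zero_mul] at h1
    simpa [Function.comp_def] using (Real.continuous_sqrt.tendsto _).comp h1
  rw [Metric.tendsto_nhds]
  intro ε hε
  obtain ⟨m, hm⟩ := (hlim.eventually (gt_mem_nhds (half_pos hε))).exists
  have h1 : Tendsto (fun n => ‖inner ℂ (W m φ) (h n)‖) atTop (𝓝 0) := by
    have h2 : Tendsto (fun n => inner ℂ (W m φ) (h n)) atTop (𝓝 (inner ℂ (W m φ) 0)) :=
      tendsto_const_nhds.inner hh
    simpa using h2.norm
  filter_upwards [h1.eventually (gt_mem_nhds (half_pos hε)), hC, eventually_ge_atTop m]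
    with n hn hCn hmn
  rw [dist_zero_right]
  linarith [key m n hmn hCn]

/-- The difference of the forms of `V` and `W n` on the form domain. -/
theorem norm_inner_sub_regularizing_sq_le (hd : Dense (T.domain : Set H))
    (hs : T.IsFormalAdjoint T) (h0 : ∀ x, 0 ≤ quad T x) (hT : IsSemibounded T)
    (hV : V.IsFormalAdjoint V) {D : Submodule ℂ H} {W : ℕ → H →L[ℂ] H}
    (hW : IsRegularizing V D W) (hTV : T.domain ≤ V.domain) {a b : ℝ}
    (hq : ∀ ψ : T.domain, quad V ⟨ψ, hTV ψ.2⟩ ≤ a * quad T ψ + b * ‖(ψ : H)‖ ^ 2)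
    {x : T†.domain} (hx : (x : H) ∈ formDomain T hT) (φ : V.domain) (n : ℕ) :
    ‖inner ℂ (V φ - W n φ) (x : H)‖ ^ 2
      ≤ (quad V φ - (inner ℂ (W n φ) (φ : H)).re) * (a * quad T† x + b * ‖(x : H)‖ ^ 2) := by
  obtain ⟨u, hu⟩ := hx
  -- Cauchy–Schwarz for the nonnegative form of `V - W n`, first at `φ` and `u k`, then `k → ∞`.
  let S : V.domain →ₗ[ℂ] H := V.toFun - (W n : H →ₗ[ℂ] H).comp V.domain.subtype
  have hS : ∀ v, S v = V v - W n v := fun v => rfl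
  have hSre : ∀ v : V.domain, (inner ℂ (S v) (v : H)).re
      = quad V v - (inner ℂ (W n v) (v : H)).re := fun v => by
    rw [hS, inner_sub_left, Complex.sub_re, quad]
  have hSp : ∀ v : V.domain, 0 ≤ (inner ℂ (S v) (v : H)).re := fun v => by
    rw [hSre]
    linarith [hW.le n v]
  have hcs := norm_inner_sq_le S V.domain.subtype (fun v w => by
    simp only [hS, Submodule.coe_subtype, inner_sub_left, inner_sub_right]
    rw [hV, (hW.pos n).inner_left_eq_inner_right]) hSp
  refine le_of_tendsto_of_tendsto' (((tendsto_const_nhds (x := V φ - W n φ)).inner hu.1).norm.pow 2)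
    ((((hu.tendsto_quad hd hs h0).const_mul a).add ((hu.1.norm.pow 2).const_mul b)).const_mul
      (quad V φ - (inner ℂ (W n φ) (φ : H)).re)) fun k => ?_
  refine (hcs φ ⟨u k, hTV (u k).2⟩).trans ?_
  have h1 := hSp φ
  simp only [Submodule.coe_subtype]
  rw [hSre φ] at h1 ⊢
  refine mul_le_mul_of_nonneg_left ?_ h1
  rw [hSre]
  have h2 : 0 ≤ (inner ℂ (W n (u k)) (u k : H)).re := (hW.pos n).re_inner_nonneg_left _
  have h3 := hq (u k)
  dsimp only at h2 h3 ⊢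
  linarith

/-- Approximation of `(S† + μ) w` by `(S + μ) φ k`, uniform on form-bounded sets. -/
theorem FormConverges.eventually_norm_inner_adjoint_sub_le {S : H →ₗ.[ℂ] H}
    (hd : Dense (T.domain : Set H)) (hs : T.IsFormalAdjoint T) (h0 : ∀ x, 0 ≤ quad T x)
    (hT : IsSemibounded T) (hSd : Dense (S.domain : Set H)) (hSs : S.IsFormalAdjoint S) {μ : ℝ}
    (hSp : ∀ x, 0 ≤ shiftQuad S μ x) (hTS : T.domain ≤ S.domain)
    (hq : ∀ ψ : T.domain, shiftQuad S μ ⟨ψ, hTS ψ.2⟩ ≤ quad T ψ + μ * ‖(ψ : H)‖ ^ 2)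
    {φ : ℕ → S.domain} {w : S†.domain} (hφ : FormConverges S φ w) {ε : ℝ} (hε : 0 < ε) :
    ∀ᶠ k in atTop, ∀ x : T†.domain, (x : H) ∈ formDomain T hT →
      ‖inner ℂ (S† w + (μ : ℂ) • (w : H) - shift S μ (φ k)) (x : H)‖
        ≤ ε * √(quad T† x + μ * ‖(x : H)‖ ^ 2) := by
  filter_upwards [hφ.eventually_norm_inner_sub_le hSs hSp hε] with k hk x hx
  obtain ⟨u, hu⟩ := hx
  refine le_of_tendsto_of_tendsto' ((tendsto_const_nhds.inner hu.1).norm)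
    (((Real.continuous_sqrt.tendsto _).comp
      ((hu.tendsto_quad hd hs h0).add ((hu.1.norm.pow 2).const_mul μ))).const_mul ε) fun j => ?_
  have h1 := hk ⟨u j, hTS (u j).2⟩
  have h2 : inner ℂ (S† w + (μ : ℂ) • (w : H) - shift S μ (φ k)) (u j : H)
      = inner ℂ ((w : H) - φ k) (shift S μ ⟨u j, hTS (u j).2⟩) := by
    rw [inner_sub_left, inner_sub_left, ← inner_adjoint_shift hSd, ← inner_shift_left hSs]
  rw [h2]
  refine h1.trans ?_
  rw [Function.comp_apply]
  gcongr
  exact hq _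

end

/-! ### Weak and strong resolvent convergence; the minimal operator -/

section

variable {H : Type*} [NormedAddCommGroup H] [InnerProductSpace ℂ H]

/-- For symmetric operators, weak convergence of resolvents at a nonreal point implies strong
convergence. -/
theorem tendsto_resolvent_of_tendsto_inner {T : ℕ → H →ₗ.[ℂ] H} {S : H →ₗ.[ℂ] H}
    (hT : ∀ n, (T n).IsFormalAdjoint (T n)) (hS : S.IsFormalAdjoint S) {z : ℂ} (hz : z.im ≠ 0)
    {R : ℕ → H →L[ℂ] H} {Q : H →L[ℂ] H} (hR : ∀ n, IsResolvent (T n) z (R n))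
    (hQ : IsResolvent S z Q) {f : H}
    (h : ∀ g : H, Tendsto (fun n => inner ℂ g (R n f)) atTop (𝓝 (inner ℂ g (Q f)))) :
    Tendsto (fun n => R n f) atTop (𝓝 (Q f)) := by
  have hn : ∀ n, (inner ℂ f (R n f)).im / z.im = ‖R n f‖ ^ 2 := fun n => by
    obtain ⟨hd, e⟩ := (hR n).1 f
    have := IsFormalAdjoint.im_inner_sub_smul (hT n) z ⟨R n f, hd⟩
    rw [e] at this
    rw [this]
    field_simp
  have hq : (inner ℂ f (Q f)).im / z.im = ‖Q f‖ ^ 2 := by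
    obtain ⟨hd, e⟩ := hQ.1 f
    have := IsFormalAdjoint.im_inner_sub_smul hS z ⟨Q f, hd⟩
    rw [e] at this
    rw [this]
    field_simp
  have h1 : Tendsto (fun n => ‖R n f‖ ^ 2) atTop (𝓝 (‖Q f‖ ^ 2)) := by
    have := ((Complex.continuous_im.tendsto _).comp (h f)).div_const z.im
    rw [hq] at this
    exact this.congr hn
  -- Weak convergence tested at `Q f`, together with convergence of norms, gives `‖Q f - R n f‖² →
  -- 0`.
  have h2 := (Complex.continuous_re.tendsto _).comp (h (Q f))
  have h3 : Tendsto (fun n => ‖Q f - R n f‖ ^ 2) atTop (𝓝 0) := by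
    have h4 := ((h2.const_mul 2).const_sub (‖Q f‖ ^ 2)).add h1
    have e : ‖Q f‖ ^ 2 - 2 * (inner ℂ (Q f) (Q f)).re + ‖Q f‖ ^ 2 = 0 := by
      have : (inner ℂ (Q f) (Q f)).re = ‖Q f‖ ^ 2 := inner_self_eq_norm_sq (𝕜 := ℂ) (Q f)
      rw [this]
      ring
    rw [e] at h4
    exact h4.congr fun n => (norm_sub_sq (𝕜 := ℂ) (Q f) (R n f)).symm
  rw [tendsto_iff_norm_sub_tendsto_zero]
  have h5 := (Real.continuous_sqrt.tendsto _).comp h3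
  rw [Real.sqrt_zero] at h5
  refine h5.congr fun n => ?_
  rw [Function.comp_apply, Real.sqrt_sq (norm_nonneg _), norm_sub_rev]

theorem mem_minimalOp_domain {A V : H →ₗ.[ℂ] H} {D : Submodule ℂ H} (hDA : D ≤ A.domain)
    (hDV : D ≤ V.domain) {α : ℝ} {f : H} (hf : f ∈ D) : f ∈ (minimalOp A V D α).domain :=
  ⟨hf, hDA hf, hDV hf⟩

theorem minimalOp_apply {A V : H →ₗ.[ℂ] H} {D : Submodule ℂ H} (hDA : D ≤ A.domain)
    (hDV : D ≤ V.domain) {α : ℝ} (f : (minimalOp A V D α).domain) :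
    minimalOp A V D α f = A ⟨f, hDA f.2.1⟩ - (α : ℂ) • V ⟨f, hDV f.2.1⟩ := rfl

theorem isFormalAdjoint_minimalOp {A V : H →ₗ.[ℂ] H} {D : Submodule ℂ H} (hDA : D ≤ A.domain)
    (hDV : D ≤ V.domain) {α : ℝ} (hA : A.IsFormalAdjoint A) (hV : V.IsFormalAdjoint V) :
    (minimalOp A V D α).IsFormalAdjoint (minimalOp A V D α) := by
  intro f g
  rw [minimalOp_apply hDA hDV, minimalOp_apply hDA hDV, inner_sub_left, inner_sub_right,
    inner_smul_left, inner_smul_right, Complex.conj_ofReal]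
  have h1 := hA ⟨f, hDA f.2.1⟩ ⟨g, hDA g.2.1⟩
  have h2 := hV ⟨f, hDV f.2.1⟩ ⟨g, hDV g.2.1⟩
  dsimp only at h1 h2
  rw [h1, h2]

theorem quad_minimalOp {A V : H →ₗ.[ℂ] H} {D : Submodule ℂ H} (hDA : D ≤ A.domain)
    (hDV : D ≤ V.domain) {α : ℝ} (f : (minimalOp A V D α).domain) :
    quad (minimalOp A V D α) f = quad A ⟨f, hDA f.2.1⟩ - α * quad V ⟨f, hDV f.2.1⟩ := by
  rw [quad, minimalOp_apply hDA hDV, inner_sub_left, inner_smul_left, Complex.conj_ofReal,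
    Complex.sub_re, Complex.re_ofReal_mul]
  rfl

end

end SingularPert

end

/-! ### The convergence theorem -/

open Filter Topology SingularPert
open scoped LinearPMap

theorem theorem2 {H : Type*} [NormedAddCommGroup H] [InnerProductSpace ℂ H] [CompleteSpace H]
    [TopologicalSpace.SeparableSpace H]
    (A V : H →ₗ.[ℂ] H)
    (hA : SingularPert.IsNonnegSelfAdjoint A) (hV : SingularPert.IsNonnegSelfAdjoint V)
    (D : Submodule ℂ H) (hD : Dense (D : Set H)) (hDA : D ≤ A.domain) (hDV : D ≤ V.domain)
    (a b : ℝ) (ha : 0 < a) (hb : 0 < b)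
    (hVA : ∀ (f : H) (hf : f ∈ A.domain) (hf' : f ∈ V.domain), f ∈ D →
      SingularPert.quad V ⟨f, hf'⟩ ≤ a * SingularPert.quad A ⟨f, hf⟩ + b * ‖f‖ ^ 2)
    (W : ℕ → H →L[ℂ] H) (hW : SingularPert.IsRegularizing V D W)
    (hadm : SingularPert.IsAdmissible (A.domRestrict D) W)
    (hdef : SingularPert.HasFiniteDeficiencyIndices (A.domRestrict D))
    (At : H →ₗ.[ℂ] H) (hAt : IsSelfAdjoint At) (hext : A.domRestrict D ≤ At)
    (α : ℝ) (hα : 0 < α) (hαa : α < 1 / a) :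
    SingularPert.StrongResolventTendsto
      (fun n => SingularPert.subBounded At ((α : ℂ) • W n))
      (SingularPert.friedrichs (SingularPert.minimalOp A V D α)
        (SingularPert.isSemibounded_minimalOp hA.2 ha hα hαa hVA)) := by
  have hαa' : α * a < 1 := by rwa [lt_div_iff₀ ha] at hαa
  have hAs := isFormalAdjoint_of_isSelfAdjoint hA.1
  have hVs := isFormalAdjoint_of_isSelfAdjoint hV.1
  have hAts := isFormalAdjoint_of_isSelfAdjoint hAt
  set hSb := isSemibounded_minimalOp hA.2 ha hα hαa hVA
  set T := A.domRestrict D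
  set S := minimalOp A V D α
  have hTA : T ≤ A := LinearPMap.domRestrict_le
  have hs : T.IsFormalAdjoint T := IsFormalAdjoint.of_le hAs hTA
  have hd : Dense (T.domain : Set H) := hD.mono fun f hf => ⟨hf, hDA hf⟩
  have h0 : ∀ x, 0 ≤ quad T x := fun x => by
    rw [quad_of_le hTA]
    exact hA.2 _
  have hT : IsSemibounded T := ⟨0, fun x => by simpa using h0 x⟩
  have hTV : T.domain ≤ V.domain := fun f hf => hDV hf.1
  have hTVq : ∀ ψ : T.domain, quad V ⟨ψ, hTV ψ.2⟩ ≤ a * quad T ψ + b * ‖(ψ : H)‖ ^ 2 :=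
    fun ψ => by
      rw [quad_of_le hTA]
      exact hVA ψ _ _ ψ.2.1
  have hWq : ∀ n, ∀ x : T.domain,
      (inner ℂ (W n x) (x : H)).re ≤ a * quad T x + b * ‖(x : H)‖ ^ 2 :=
    fun n x => (hW.le n ⟨x, hTV x.2⟩).trans (hTVq x)
  have hSs : S.IsFormalAdjoint S := isFormalAdjoint_minimalOp hDA hDV hAs hVs
  have hSd : Dense (S.domain : Set H) := hD.mono fun f hf => mem_minimalOp_domain hDA hDV hf
  have hTS : T.domain ≤ S.domain := fun f hf => mem_minimalOp_domain hDA hDV hf.1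
  have hμ : 0 ≤ α * b := by positivity
  have hSp : ∀ x, 0 ≤ shiftQuad S (α * b) x := fun x => by
    rw [shiftQuad_eq, quad_minimalOp hDA hDV]
    have h1 := mul_le_mul_of_nonneg_left (hVA x (hDA x.2.1) (hDV x.2.1) x.2.1) hα.le
    have h2 := mul_nonneg (sub_nonneg.2 hαa'.le) (hA.2 ⟨x, hDA x.2.1⟩)
    linarith
  -- As `V ≥ 0`, the form of `S + αb` is dominated by that of `T + αb`, so the bounds on `x n` in
  -- the form of `T` also control it in the form of `S`.
  have hTSq : ∀ ψ : T.domain,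
      shiftQuad S (α * b) ⟨ψ, hTS ψ.2⟩ ≤ quad T ψ + α * b * ‖(ψ : H)‖ ^ 2 := fun ψ => by
    rw [shiftQuad_eq, quad_minimalOp hDA hDV, quad_of_le hTA]
    have h1 := mul_nonneg hα.le (hV.2 ⟨ψ, hTV ψ.2⟩)
    dsimp only at h1 ⊢
    linarith
  obtain ⟨η, hη, hadm'⟩ := hadm
  have := hdef.1
  have hfin : FiniteDimensional ℂ (kerSub T† (η : ℂ)) :=
    finiteDimensional_kerSub_adjoint hd hA hTA hη
  have hHn : ∀ n, IsSelfAdjoint (subBounded At ((α : ℂ) • W n)) := fun n =>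
    isSelfAdjoint_subBounded hAt fun x y => by
      rw [smul_apply, smul_apply, inner_smul_left, inner_smul_right,
        Complex.conj_ofReal, (hW.pos n).inner_left_eq_inner_right]
  have hHns := fun n => isFormalAdjoint_of_isSelfAdjoint (hHn n)
  have hF : IsSelfAdjoint (friedrichs S hSb) := isSelfAdjoint_friedrichs hSd hSs hSb
  have hFs := isFormalAdjoint_of_isSelfAdjoint hF
  intro z hz
  choose R hR using fun n => exists_isResolvent_of_isSelfAdjoint (hHn n) hz
  obtain ⟨Q, hQ⟩ := exists_isResolvent_of_isSelfAdjoint hF hz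
  have hz' : ((starRingEnd ℂ) z).im ≠ 0 := by simpa using hz
  obtain ⟨Q', hQ'⟩ := exists_isResolvent_of_isSelfAdjoint hF hz'
  refine ⟨R, Q, hR, hQ, fun f => tendsto_resolvent_of_tendsto_inner hHns hFs hz hR hQ fun g => ?_⟩
  have hz0 : 0 < |z.im| := abs_pos.2 hz
  have hRdom : ∀ n, R n f ∈ At.domain := fun n => ((hR n).1 f).1
  have hReq : ∀ n, subBounded At ((α : ℂ) • W n) ⟨R n f, hRdom n⟩ - z • R n f = f :=
    fun n => ((hR n).1 f).2
  have hRb : ∀ n, ‖R n f‖ ≤ ‖f‖ / |z.im| := fun n => by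
    have h1 := IsFormalAdjoint.abs_im_mul_norm_le (hHns n) z ⟨R n f, hRdom n⟩
    rw [hReq n] at h1
    rw [le_div_iff₀ hz0, mul_comm]
    exact h1
  obtain ⟨C, hC, hev⟩ := exists_eventually_decomposition_bounded hd hs h0 hT hW.pos hW.mono hb hα
    hαa' hη hWq hadm' hAts hext z f (U := ‖f‖ / |z.im|) (by positivity)
  obtain ⟨x, hx⟩ := (hev.mono fun n hn => hn ⟨R n f, hRdom n⟩ (hRb n) (hReq n)).choice
  dsimp only at hx
  let h : ℕ → H := fun n => R n f - x n
  have hh0 : Tendsto h atTop (𝓝 0) := by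
    rw [Metric.tendsto_nhds]
    intro ε hε
    -- With this growth constant, `‖h n‖ ≥ ε` would give `(W n (h n), h n) ≥ C + 1`, above the bound
    -- `C`.
    obtain ⟨n₀, hn₀⟩ := exists_forall_mul_norm_sq_le hW.mono _ hadm' ((C + 1) / ε ^ 2)
    filter_upwards [hx, eventually_ge_atTop n₀] with n hxn hn
    have h1 := (hn₀ n hn _ hxn.2.1).trans hxn.2.2.2.2
    rw [dist_zero_right]
    by_contra hcon
    have h2 : ε ^ 2 ≤ ‖R n f - x n‖ ^ 2 := by
      gcongr
      exact not_lt.1 hcon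
    have h3 : (C + 1) / ε ^ 2 * ε ^ 2 ≤ (C + 1) / ε ^ 2 * ‖R n f - x n‖ ^ 2 := by gcongr
    rw [div_mul_cancel₀ _ (by positivity)] at h3
    linarith
  have hhW : ∀ᶠ n in atTop, (inner ℂ (W n (h n)) (h n)).re ≤ C := hx.mono fun n hn => hn.2.2.2.2
  have hsplit : ∀ n, R n f = x n + h n := fun n => by simp [h]
  -- Weak form of the limit equation on `D`. The error consists of `(W n φ, h n)`, `((V - W n) φ, x
  -- n)` and a fixed vector paired with `h n`, all tending to zero.
  have hcore : ∀ φ : S.domain, Tendsto (fun n =>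
      inner ℂ (S φ - (starRingEnd ℂ) z • (φ : H)) (x n : H) - inner ℂ (φ : H) f) atTop (𝓝 0) := by
    intro φ
    have hφV : (φ : H) ∈ V.domain := hDV φ.2.1
    have hφA : (φ : H) ∈ A.domain := hDA φ.2.1
    have hφT : (φ : H) ∈ T.domain := ⟨φ.2.1, hφA⟩
    have t1 : Tendsto (fun n => inner ℂ (V ⟨φ, hφV⟩ - W n φ) (x n : H)) atTop (𝓝 0) := by
      have l1 := ((hW.tendsto ⟨φ, hφV⟩ φ.2.1).const_sub (quad V ⟨φ, hφV⟩)).mul_const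
        (a * C + b * C)
      rw [sub_self, zero_mul] at l1
      have l2 := (Real.continuous_sqrt.tendsto _).comp l1
      rw [Real.sqrt_zero] at l2
      refine squeeze_zero_norm' (hx.mono fun n hn => ?_) l2
      refine Real.le_sqrt_of_sq_le ((norm_inner_sub_regularizing_sq_le hd hs h0 hT hVs hW hTV hTVq
        hn.1 ⟨φ, hφV⟩ n).trans ?_)
      have h1 := hW.le n ⟨φ, hφV⟩
      have h2 := hn.2.2.1
      have h3 := hn.2.2.2.1
      exact mul_le_mul_of_nonneg_left (by gcongr) (sub_nonneg.2 h1)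
    have t2 : Tendsto (fun n => inner ℂ (A ⟨φ, hφA⟩ - (starRingEnd ℂ) z • (φ : H)) (h n)) atTop
        (𝓝 (inner ℂ (A ⟨φ, hφA⟩ - (starRingEnd ℂ) z • (φ : H)) 0)) := tendsto_const_nhds.inner hh0
    rw [inner_zero_right] at t2
    have t3 := tendsto_inner_regularizing hW hh0 hhW (φ := ⟨φ, hφV⟩) φ.2.1
    have t4 := ((t3.const_mul (α : ℂ)).sub (t1.const_mul (α : ℂ))).sub t2
    rw [mul_zero, sub_zero, sub_zero] at t4
    refine t4.congr fun n => ?_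
    -- The resolvent equation with the operator moved to `φ`, where `At` acts as `A`.
    have e1 : inner ℂ (φ : H) f
        = inner ℂ (A ⟨φ, hφA⟩ - (α : ℂ) • W n φ - (starRingEnd ℂ) z • (φ : H)) (R n f) := by
      have e2 := IsFormalAdjoint.inner_sub_smul (hHns n) ((starRingEnd ℂ) z)
        ⟨φ, hext.1 hφT⟩ ⟨R n f, hRdom n⟩
      rw [Complex.conj_conj] at e2
      change _ = inner ℂ (φ : H) (subBounded At ((α : ℂ) • W n) ⟨R n f, hRdom n⟩ - z • R n f) at e2
      rw [hReq n] at e2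
      rw [← e2]
      change inner ℂ (At ⟨φ, hext.1 hφT⟩ - (α : ℂ) • W n φ - (starRingEnd ℂ) z • (φ : H))
        (R n f) = _
      rw [← hext.2 (x := ⟨φ, hφT⟩) rfl]
      rfl
    have e3 : S φ = A ⟨φ, hφA⟩ - (α : ℂ) • V ⟨φ, hφV⟩ := rfl
    rw [e1, hsplit n, e3]
    simp only [inner_sub_left, inner_add_right, inner_smul_left, Complex.conj_ofReal]
    ring
  obtain ⟨hwd, hwe⟩ := hQ'.1 g
  obtain ⟨φ, hφ⟩ := hwd.1
  set w : S†.domain := ⟨Q' g, hwd.2⟩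
  replace hφ : FormConverges S φ (w : H) := hφ
  have hwe' : S† w - (starRingEnd ℂ) z • (w : H) = g := hwe
  have hlim : inner ℂ g (Q f) = inner ℂ (w : H) f := by
    have := IsResolvent.inner_eq hFs hQ hQ' f g
    rw [← inner_conj_symm, ← this, inner_conj_symm]
  rw [hlim, Metric.tendsto_nhds]
  intro ε hε
  -- Four errors of size `ε / 4`: the `h n` term, the form approximation of `w` by `φ k`, the two
  -- norm terms in `w - φ k` together, and `hcore` at `φ k`. The index `k` is fixed first, by bounds
  -- uniform in `n`.
  have hε4 : 0 < ε / 4 := by positivity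
  have hε1 : 0 < ε / 4 / (√(C + α * b * C) + 1) := by positivity
  have hk1 := hφ.eventually_norm_inner_adjoint_sub_le hd hs h0 hT hSd hSs hSp hTS hTSq hε1
  have hk2 : Tendsto (fun k => ‖(w : H) - φ k‖ *
      (‖(starRingEnd ℂ) z + ((α * b : ℝ) : ℂ)‖ * √C + ‖f‖)) atTop (𝓝 0) := by
    simpa using ((hφ.1.const_sub (w : H)).norm).mul_const
      (‖(starRingEnd ℂ) z + ((α * b : ℝ) : ℂ)‖ * √C + ‖f‖)
  obtain ⟨k, hk, hk'⟩ := (hk1.and (hk2.eventually (gt_mem_nhds hε4))).exists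
  have hg0 : Tendsto (fun n => inner ℂ g (h n)) atTop (𝓝 (inner ℂ g 0)) :=
    tendsto_const_nhds.inner hh0
  rw [inner_zero_right] at hg0
  have hε0 : ‖(0 : ℂ)‖ < ε / 4 := by rwa [norm_zero]
  filter_upwards [hx, (hcore (φ k)).norm.eventually (gt_mem_nhds hε0),
    hg0.norm.eventually (gt_mem_nhds hε0)] with n hxn h3 h1
  have h2 := hk (x n) hxn.1
  have h2' : ‖inner ℂ (S† w + ((α * b : ℝ) : ℂ) • (w : H) - shift S (α * b) (φ k)) (x n : H)‖
      ≤ ε / 4 := by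
    refine h2.trans ?_
    have b1 : √(quad T† (x n) + α * b * ‖(x n : H)‖ ^ 2) ≤ √(C + α * b * C) + 1 := by
      refine le_trans (Real.sqrt_le_sqrt ?_) (le_add_of_nonneg_right zero_le_one)
      have := hxn.2.2.1
      have := hxn.2.2.2.1
      gcongr
    calc _ ≤ ε / 4 / (√(C + α * b * C) + 1) * (√(C + α * b * C) + 1) := by gcongr
      _ = ε / 4 := div_mul_cancel₀ _ (by positivity)
  have hxC : ‖(x n : H)‖ ≤ √C := Real.le_sqrt_of_sq_le hxn.2.2.2.1
  have h4 : ‖inner ℂ (((starRingEnd ℂ) z + ((α * b : ℝ) : ℂ)) • ((w : H) - φ k)) (x n : H)‖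
      ≤ ‖(starRingEnd ℂ) z + ((α * b : ℝ) : ℂ)‖ * ‖(w : H) - φ k‖ * √C := by
    refine (norm_inner_le_norm _ _).trans ?_
    rw [norm_smul]
    gcongr
  have h5 : ‖inner ℂ ((w : H) - φ k) f‖ ≤ ‖(w : H) - φ k‖ * ‖f‖ := norm_inner_le_norm _ _
  have hsum : inner ℂ g (R n f) - inner ℂ (w : H) f
      = inner ℂ g (h n)
        + inner ℂ (S† w + ((α * b : ℝ) : ℂ) • (w : H) - shift S (α * b) (φ k)) (x n : H)
        - inner ℂ (((starRingEnd ℂ) z + ((α * b : ℝ) : ℂ)) • ((w : H) - φ k)) (x n : H)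
        + (inner ℂ (S (φ k) - (starRingEnd ℂ) z • (φ k : H)) (x n : H) - inner ℂ (φ k : H) f)
        - inner ℂ ((w : H) - φ k) f := by
    have e1 : g = (S† w + ((α * b : ℝ) : ℂ) • (w : H) - shift S (α * b) (φ k))
        - ((starRingEnd ℂ) z + ((α * b : ℝ) : ℂ)) • ((w : H) - φ k)
        + (S (φ k) - (starRingEnd ℂ) z • (φ k : H)) := by
      rw [← hwe', shift_apply]
      module
    have e2 := congrArg (fun v => inner ℂ v (x n : H)) e1
    rw [inner_add_left, inner_sub_left] at e2
    rw [hsplit n, inner_add_right, e2, inner_sub_left (w : H)]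
    ring
  rw [dist_eq_norm, hsum]
  refine lt_of_le_of_lt ((norm_sub_le _ _).trans (add_le_add_left ((norm_add_le _ _).trans
    (add_le_add_left ((norm_sub_le _ _).trans (add_le_add_left (norm_add_le _ _) _)) _)) _)) ?_
  have h6 : ‖(w : H) - φ k‖ * (‖(starRingEnd ℂ) z + ((α * b : ℝ) : ℂ)‖ * √C + ‖f‖)
      = ‖(starRingEnd ℂ) z + ((α * b : ℝ) : ℂ)‖ * ‖(w : H) - φ k‖ * √C
        + ‖(w : H) - φ k‖ * ‖f‖ := by ring
  rw [h6] at hk'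
  linarith
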